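/- Let $\mathbb{RP}^1$ be the set of lines through the origin of $\mathbb{R}^2$ with its usual topology, on which $GL_2(\mathbb{R})$ acts by $V\mapsto AV$, and let $\|\cdot\|$ be the Euclidean operator norm. For $\mathsf{A}\subset GL_2(\mathbb{R})$ let $\mathcal{S}(\mathsf{A})=\{A_1\cdots A_n : n\ge 1,\ A_i\in\mathsf{A}\}$ be the sub-semigroup generated by $\mathsf{A}$. - A semigroup $\mathcal{S}\subset GL_2(\mathbb{R})$ is *almost multiplicative* if there is $\kappa>0$ such that $\|AB\|\ge\kappa\|A\|\|B\|$ for all $A,B\in\mathcal{S}$. - A set $\mathsf{A}\subset GL_2(\mathbb{R})$ is *strongly conformal* if there is one $M\in GL_2(\mathbb{R})$ such that $|\det A|^{-1/2}MAM^{-1}\in O(2)$ for all $A\in\mathsf{A}$. - A *multicone* is a nonempty proper subset of $\mathbb{RP}^1$ that is a finite union of closed nondegenerate projective intervals, that is, of sets $\{\mathbb{R}(\cos\theta,\sin\theta) : a\le\theta\le b\}$ with $a<b<a+\pi$. - A multicone $\mathcal{C}$ is *strongly invariant* for $\mathsf{A}$ if $A\mathcal{C}\subset\mathcal{C}^o$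 for all $A\in\mathsf{A}$, where $\mathcal{C}^o$ is the interior of $\mathcal{C}$. **Corollary.** Let $\mathsf{A}\subset GL_2(\mathbb{R})$ be finite. Then the following two statements are equivalent: 1. the sub-semigroup $\mathcal{S}(\mathsf{A})$ is almost multiplicative; 2. there are sets $\mathsf{A}_e,\mathsf{A}_h$ with $\mathsf{A}=\mathsf{A}_e\cup\mathsf{A}_h$ such that $\mathsf{A}_e$ is strongly conformal and, if $\mathsf{A}_h\neq\emptyset$, then $\mathsf{A}_h$ has a strongly invariant multicone $\mathcal{C}$ such that $A\mathcal{C}=\mathcal{C}$ for all $A\in\mathsf{A}_e$. -/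

import Mathlib

open scoped MatrixGroups LinearAlgebra.Projectivization

noncomputable section

namespace PlanarCocycle

/-- The real projective line: the set of all lines through the origin of `ℝ²`. -/
abbrev RP1 : Type := ℙ ℝ (Fin 2 → ℝ)

/-- The usual topology of the projective line: the quotient topology coming from `ℝ² \ {0}`. -/
instance instTopologicalSpaceRP1 : TopologicalSpace RP1 :=
  TopologicalSpace.coinduced (Projectivization.mk' ℝ (V := Fin 2 → ℝ)) inferInstance

/-- The unit vector of angle `θ`. -/
def dirVec (θ : ℝ) : Fin 2 → ℝ := ![Real.cos θ, Real.sin θ]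

theorem dirVec_ne_zero (θ : ℝ) : dirVec θ ≠ 0 := by
  intro h
  have h0 : Real.cos θ = 0 := congrFun h 0
  have h1 : Real.sin θ = 0 := congrFun h 1
  have := Real.sin_sq_add_cos_sq θ
  simp [h0, h1] at this

/-- The line spanned by the unit vector of angle `θ`. -/
def dir (θ : ℝ) : RP1 := Projectivization.mk ℝ (dirVec θ) (dirVec_ne_zero θ)

/-- Closed (nondegenerate, proper) projective intervals: the sets of all lines whose angle is in
`[a, b]`, where `a < b < a + π`. -/
def IsClosedInterval (I : Set RP1) : Prop :=
  ∃ a b : ℝ, a < b ∧ b < a + Real.pi ∧ I = dir '' Set.Icc a b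

/-- A multicone: a nonempty proper subset of the projective line that is a finite union of closed
projective intervals. -/
def IsMulticone (C : Set RP1) : Prop :=
  C.Nonempty ∧ C ≠ Set.univ ∧
    ∃ F : Set (Set RP1), F.Finite ∧ (∀ I ∈ F, IsClosedInterval I) ∧ C = ⋃₀ F

/-- The image `g C` of a set of lines under the projective action of `g ∈ GL₂(ℝ)`. -/
def imageCone (g : GL (Fin 2) ℝ) (C : Set RP1) : Set RP1 := (fun x : RP1 => g • x) '' C

/-- `C` is a strongly invariant multicone for `A`. -/
def IsStronglyInvariantMulticone (C : Set RP1) (A : Set (GL (Fin 2) ℝ)) : Prop :=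
  IsMulticone C ∧ ∀ g ∈ A, imageCone g C ⊆ interior C

/-- `A` is strongly conformal: there is one conjugation matrix `M ∈ GL₂(ℝ)` such that
`|det g|^(-1/2) M g M⁻¹ ∈ O(2)` for all `g ∈ A`. -/
def StronglyConformal (A : Set (GL (Fin 2) ℝ)) : Prop :=
  ∃ M : GL (Fin 2) ℝ, ∀ g ∈ A,
    |(g : Matrix (Fin 2) (Fin 2) ℝ).det| ^ (-(1 / 2) : ℝ) •
      ((M * g * M⁻¹ : GL (Fin 2) ℝ) : Matrix (Fin 2) (Fin 2) ℝ) ∈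
        Matrix.orthogonalGroup (Fin 2) ℝ

/-- The operator norm of a matrix acting on the Euclidean plane. -/
def opNorm (g : GL (Fin 2) ℝ) : ℝ :=
  ‖Matrix.toEuclideanCLM (n := Fin 2) (𝕜 := ℝ) (g : Matrix (Fin 2) (Fin 2) ℝ)‖

/-- A semigroup `S` of invertible matrices is almost multiplicative if, for some `κ > 0`,
`‖g h‖ ≥ κ ‖g‖ ‖h‖` for all `g, h ∈ S`. -/
def AlmostMultiplicative (S : Subsemigroup (GL (Fin 2) ℝ)) : Prop :=
  ∃ κ : ℝ, 0 < κ ∧ ∀ g ∈ S, ∀ h ∈ S, κ * opNorm g * opNorm h ≤ opNorm (g * h)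

end PlanarCocycle

end

/-!
Both directions rest on the following property of an invertible matrix `g` of the plane. Write
`|v|` for the Euclidean norm, and measure the distance of two lines by the sine of their angle.
If a set `C` of lines omits an open set and `g C ⊆ C`, then `g` expands the vectors `v` deep inside
`C` by a fixed fraction of `‖g‖` (`mul_norm_mul_nrm_le_of_sinDist`): for a line `p` outside `C` the
line `g⁻¹ p` is outside `C` as well, so `|g v| |p| ≥ |g v ∧ p| = |det g| |v ∧ g⁻¹ p|` is large.

*From the multicone to almost multiplicativity.* A word in the generators is either a product of
similarities, for which everything is clear, or has the form `E H B`, where `E` is a product of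
similarities, `H` maps `C` strictly inside itself and `B` preserves `C`. On vectors of `H C` the
expansion property applies to every word, and it gives `‖g E H B‖ ≥ const ‖g‖ ‖E H B‖`.

*From almost multiplicativity to the multicone.* Normalize all determinants to `±1` and let `Γ` be
the closure of the generated monoid; the norm is still almost multiplicative on `Γ`. The members of
`Γ` with inverse in `Γ` form a group, which is bounded because `1 = ‖g g⁻¹‖ ≥ κ ‖g‖ ‖g⁻¹‖`. So it
preserves a Euclidean structure (`exists_invariant_norm`), and after a conjugation it consists of
isometries. The elliptic generators are those whose normalization lies in this group; let `S` be
the set of the other normalized generators.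

By compactness, a product with a factor in `S` stays away from the identity, and a pigeonhole
argument on the suffixes of a word shows that words with many letters in `S` have large norm
(`IsAlmostMulMonoid.exists_lt_norm`). Let `K₀` be the set of the lines that every `g ∈ Γ` expands
by at least `(κ / 4) ‖g‖`, and let `K_k` be its image under the words with `k` letters in `S`.
A matrix of large norm maps `K₀` into the set of lines expanded by at least `(κ / 2) ‖g‖`
(`IsAlmostMulMonoid.isExpanded_of_large`), so `K_{N + 1}` lies well inside `K₀` for some `N`. The
union of the `ε_k`-neighbourhoods of `K_0, …, K_N`, with small radii `ε_k` growing fast enough to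
beat the Lipschitz constants of `S`, is the multicone (`IsAlmostMulMonoid.exists_multicone`).
Neighbourhoods of sets of lines are finite unions of intervals
(`exists_finite_intervals_nearCone`), and isometries preserve them exactly.
-/

namespace PlanarCocycle

open scoped Matrix Matrix.Norms.L2Operator
open Projectivization Set

/-! ### Norm, area and angle in the plane -/

/-- The Euclidean norm of a vector of the plane. -/
noncomputable def nrm (v : Fin 2 → ℝ) : ℝ := √(v 0 ^ 2 + v 1 ^ 2)

/-- The oriented area of the parallelogram spanned by two vectors of the plane. -/
def wedge (v w : Fin 2 → ℝ) : ℝ := v 0 * w 1 - v 1 * w 0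

theorem nrm_eq_norm (v : Fin 2 → ℝ) : nrm v = ‖(WithLp.toLp 2 v : EuclideanSpace ℝ (Fin 2))‖ := by
  simp [nrm, EuclideanSpace.norm_eq, Fin.sum_univ_two]

theorem nrm_nonneg (v : Fin 2 → ℝ) : 0 ≤ nrm v := Real.sqrt_nonneg _

theorem nrm_sq (v : Fin 2 → ℝ) : nrm v ^ 2 = v 0 ^ 2 + v 1 ^ 2 :=
  Real.sq_sqrt (by positivity)

theorem nrm_pos {v : Fin 2 → ℝ} (hv : v ≠ 0) : 0 < nrm v := by
  rw [nrm_eq_norm]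
  simpa using hv

theorem nrm_zero : nrm 0 = 0 := by simp [nrm]

theorem nrm_smul (c : ℝ) (v : Fin 2 → ℝ) : nrm (c • v) = |c| * nrm v := by
  rw [nrm_eq_norm, nrm_eq_norm, WithLp.toLp_smul, norm_smul, Real.norm_eq_abs]

theorem nrm_add_le (v w : Fin 2 → ℝ) : nrm (v + w) ≤ nrm v + nrm w := by
  rw [nrm_eq_norm, nrm_eq_norm, nrm_eq_norm, WithLp.toLp_add]
  exact norm_add_le _ _

theorem nrm_dirVec (θ : ℝ) : nrm (dirVec θ) = 1 := by
  simp [nrm, dirVec]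

theorem nrm_mulVec_le (g : Matrix (Fin 2) (Fin 2) ℝ) (v : Fin 2 → ℝ) :
    nrm (g *ᵥ v) ≤ ‖g‖ * nrm v := by
  rw [nrm_eq_norm, nrm_eq_norm]
  exact Matrix.l2_opNorm_mulVec g (WithLp.toLp 2 v)

theorem norm_le_of_nrm_mulVec_le {g : Matrix (Fin 2) (Fin 2) ℝ} {C : ℝ} (hC : 0 ≤ C)
    (h : ∀ v, nrm (g *ᵥ v) ≤ C * nrm v) : ‖g‖ ≤ C := by
  rw [← Matrix.l2_opNorm_toEuclideanCLM]
  refine ContinuousLinearMap.opNorm_le_bound _ hC fun x => ?_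
  have := h x.ofLp
  rw [nrm_eq_norm, nrm_eq_norm] at this
  exact this

theorem exists_lt_nrm_mulVec {g : Matrix (Fin 2) (Fin 2) ℝ} {C : ℝ} (hC : 0 ≤ C) (h : C < ‖g‖) :
    ∃ v, v ≠ 0 ∧ C * nrm v < nrm (g *ᵥ v) := by
  by_contra! hcon
  refine absurd (norm_le_of_nrm_mulVec_le hC fun v => ?_) (not_le.mpr h)
  by_cases hv : v = 0
  · subst hv
    simp [nrm_zero]
  · exact hcon v hv

theorem norm_one_mat : ‖(1 : Matrix (Fin 2) (Fin 2) ℝ)‖ = 1 := by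
  simp

theorem wedge_smul_left (c : ℝ) (v w : Fin 2 → ℝ) : wedge (c • v) w = c * wedge v w := by
  simp [wedge]; ring

theorem wedge_smul_right (c : ℝ) (v w : Fin 2 → ℝ) : wedge v (c • w) = c * wedge v w := by
  simp [wedge]; ring

theorem wedge_swap (v w : Fin 2 → ℝ) : wedge v w = -wedge w v := by
  simp [wedge]; ring

theorem wedge_mulVec (g : Matrix (Fin 2) (Fin 2) ℝ) (v w : Fin 2 → ℝ) :
    wedge (g *ᵥ v) (g *ᵥ w) = g.det * wedge v w := by
  simp [wedge, Matrix.mulVec, dotProduct, Fin.sum_univ_two, Matrix.det_fin_two]; ring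

theorem wedge_dirVec (a b : ℝ) : wedge (dirVec a) (dirVec b) = Real.sin (b - a) := by
  simp [wedge, dirVec, Real.sin_sub]; ring

/-- Lagrange's identity. -/
theorem dotProduct_sq_add_wedge_sq (v w : Fin 2 → ℝ) :
    (v ⬝ᵥ w) ^ 2 + wedge v w ^ 2 = (nrm v * nrm w) ^ 2 := by
  rw [mul_pow, nrm_sq, nrm_sq]
  simp [wedge, dotProduct, Fin.sum_univ_two]; ring

theorem abs_wedge_le (v w : Fin 2 → ℝ) : |wedge v w| ≤ nrm v * nrm w := by
  refine abs_le_of_sq_le_sq ?_ (mul_nonneg (nrm_nonneg _) (nrm_nonneg _))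
  nlinarith [dotProduct_sq_add_wedge_sq v w, sq_nonneg (v ⬝ᵥ w)]

theorem abs_dotProduct_le (v w : Fin 2 → ℝ) : |v ⬝ᵥ w| ≤ nrm v * nrm w := by
  refine abs_le_of_sq_le_sq ?_ (mul_nonneg (nrm_nonneg _) (nrm_nonneg _))
  nlinarith [dotProduct_sq_add_wedge_sq v w, sq_nonneg (wedge v w)]

/-- The rotation of a vector by a right angle. -/
def perp (v : Fin 2 → ℝ) : Fin 2 → ℝ := ![-v 1, v 0]

theorem nrm_perp (v : Fin 2 → ℝ) : nrm (perp v) = nrm v := by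
  simp [nrm, perp, add_comm]

theorem wedge_perp (v : Fin 2 → ℝ) : wedge v (perp v) = nrm v ^ 2 := by
  rw [nrm_sq]
  simp [wedge, perp]; ring

/-- The decomposition of `w` along `v` and the direction orthogonal to `v`. -/
theorem nrm_sq_smul_eq (v w : Fin 2 → ℝ) :
    nrm v ^ 2 • w = (v ⬝ᵥ w) • v + wedge v w • perp v := by
  rw [nrm_sq]
  ext i
  fin_cases i <;> simp [wedge, perp, dotProduct, Fin.sum_univ_two] <;> ring

theorem nrm_sq_mul_nrm_mulVec_le (g : Matrix (Fin 2) (Fin 2) ℝ) (v w : Fin 2 → ℝ) :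
    nrm v ^ 2 * nrm (g *ᵥ w) ≤ |v ⬝ᵥ w| * nrm (g *ᵥ v) + |wedge v w| * (‖g‖ * nrm v) := by
  have h : nrm (g *ᵥ (nrm v ^ 2 • w)) = nrm v ^ 2 * nrm (g *ᵥ w) := by
    rw [Matrix.mulVec_smul, nrm_smul, abs_of_nonneg (by positivity)]
  rw [← h, nrm_sq_smul_eq, Matrix.mulVec_add, Matrix.mulVec_smul, Matrix.mulVec_smul]
  refine (nrm_add_le _ _).trans ?_
  rw [nrm_smul, nrm_smul]
  have := nrm_mulVec_le g (perp v)
  rw [nrm_perp] at this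
  gcongr

theorem mulVec_ne_zero {g : Matrix (Fin 2) (Fin 2) ℝ} (hg : g.det ≠ 0) {v : Fin 2 → ℝ}
    (hv : v ≠ 0) : g *ᵥ v ≠ 0 := fun h =>
  hv (Matrix.eq_zero_of_mulVec_eq_zero hg h)

/-- In the plane a matrix and its inverse have the same norm, up to the determinant. -/
theorem abs_det_mul_norm_inv {g : Matrix (Fin 2) (Fin 2) ℝ} (hg : g.det ≠ 0) :
    |g.det| * ‖g⁻¹‖ ≤ ‖g‖ := by
  have hd : 0 < |g.det| := abs_pos.mpr hg
  rw [← le_div_iff₀' hd]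
  refine norm_le_of_nrm_mulVec_le (by positivity) fun u => ?_
  by_cases hu : g⁻¹ *ᵥ u = 0
  · rw [hu, nrm_zero]
    exact mul_nonneg (by positivity) (nrm_nonneg _)
  have hpos := nrm_pos hu
  set x := g⁻¹ *ᵥ u with hx
  have hgx : g *ᵥ x = u := by
    rw [hx, Matrix.mulVec_mulVec, Matrix.mul_nonsing_inv _ (isUnit_iff_ne_zero.mpr hg),
      Matrix.one_mulVec]
  have h1 := wedge_mulVec g x (perp x)
  rw [hgx, wedge_perp] at h1
  have h2 := abs_wedge_le u (g *ᵥ perp x)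
  rw [h1, abs_mul, abs_of_nonneg (sq_nonneg (nrm x))] at h2
  have h3 := nrm_mulVec_le g (perp x)
  rw [nrm_perp] at h3
  have h4 : |g.det| * nrm x ^ 2 ≤ nrm u * (‖g‖ * nrm x) :=
    h2.trans (mul_le_mul_of_nonneg_left h3 (nrm_nonneg _))
  rw [div_mul_eq_mul_div, le_div_iff₀ hd]
  nlinarith [h4]

theorem one_le_norm {g : Matrix (Fin 2) (Fin 2) ℝ} (hg : |g.det| = 1) : 1 ≤ ‖g‖ := by
  have hg0 : g.det ≠ 0 := by
    intro h
    simp [h] at hg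
  have h1 := abs_det_mul_norm_inv hg0
  have h2 := norm_mul_le g g⁻¹
  rw [Matrix.mul_nonsing_inv _ (isUnit_iff_ne_zero.mpr hg0), norm_one_mat] at h2
  rw [hg, one_mul] at h1
  nlinarith [norm_nonneg g, norm_nonneg g⁻¹]

/-- The sine of the angle between the lines spanned by two vectors. -/
noncomputable def sinDist (v w : Fin 2 → ℝ) : ℝ := |wedge v w| / (nrm v * nrm w)

theorem sinDist_smul_left {c : ℝ} (hc : c ≠ 0) (v w : Fin 2 → ℝ) :
    sinDist (c • v) w = sinDist v w := by
  have : |c| ≠ 0 := abs_ne_zero.mpr hc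
  rw [sinDist, sinDist, wedge_smul_left, nrm_smul, abs_mul, mul_assoc, mul_div_mul_left _ _ this]

theorem sinDist_comm (v w : Fin 2 → ℝ) : sinDist v w = sinDist w v := by
  rw [sinDist, sinDist, wedge_swap, abs_neg, mul_comm (nrm v)]

theorem sinDist_smul_right {c : ℝ} (hc : c ≠ 0) (v w : Fin 2 → ℝ) :
    sinDist v (c • w) = sinDist v w := by
  rw [sinDist_comm, sinDist_smul_left hc, sinDist_comm]

theorem sinDist_self (v : Fin 2 → ℝ) : sinDist v v = 0 := by
  simp [sinDist, wedge, mul_comm]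

theorem sinDist_nonneg (v w : Fin 2 → ℝ) : 0 ≤ sinDist v w :=
  div_nonneg (abs_nonneg _) (mul_nonneg (nrm_nonneg _) (nrm_nonneg _))

theorem sinDist_dirVec (a b : ℝ) : sinDist (dirVec a) (dirVec b) = |Real.sin (a - b)| := by
  rw [sinDist, wedge_dirVec, nrm_dirVec, nrm_dirVec, ← abs_neg, ← Real.sin_neg]
  simp

theorem abs_wedge_eq {v w : Fin 2 → ℝ} (hv : v ≠ 0) (hw : w ≠ 0) :
    |wedge v w| = sinDist v w * (nrm v * nrm w) := by
  have := nrm_pos hv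
  have := nrm_pos hw
  rw [sinDist]
  field_simp

/-- Invertible matrices are Lipschitz maps for the sine distance. -/
theorem sinDist_mulVec_le {g : Matrix (Fin 2) (Fin 2) ℝ} (hg : g.det ≠ 0) {v w : Fin 2 → ℝ}
    (hv : v ≠ 0) (hw : w ≠ 0) :
    sinDist (g *ᵥ v) (g *ᵥ w) ≤ |g.det| * ‖g⁻¹‖ ^ 2 * sinDist v w := by
  have hinv : ∀ u, nrm u ≤ ‖g⁻¹‖ * nrm (g *ᵥ u) := fun u => by
    have := nrm_mulVec_le g⁻¹ (g *ᵥ u)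
    rwa [Matrix.mulVec_mulVec, Matrix.nonsing_inv_mul _ (isUnit_iff_ne_zero.mpr hg),
      Matrix.one_mulVec] at this
  have h1 := nrm_pos (mulVec_ne_zero hg hv)
  have h2 := nrm_pos (mulVec_ne_zero hg hw)
  rw [sinDist, div_le_iff₀ (by positivity), wedge_mulVec, abs_mul, abs_wedge_eq hv hw]
  have h3 : nrm v * nrm w ≤ (‖g⁻¹‖ * nrm (g *ᵥ v)) * (‖g⁻¹‖ * nrm (g *ᵥ w)) :=
    mul_le_mul (hinv v) (hinv w) (nrm_nonneg _) (by positivity)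
  have h4 : 0 ≤ |g.det| * sinDist v w := mul_nonneg (abs_nonneg _) (sinDist_nonneg _ _)
  nlinarith [mul_le_mul_of_nonneg_left h3 h4]

theorem continuous_wedge {X : Type*} [TopologicalSpace X] {f g : X → Fin 2 → ℝ}
    (hf : Continuous f) (hg : Continuous g) : Continuous fun x => wedge (f x) (g x) := by
  unfold wedge
  fun_prop

theorem continuous_nrm {X : Type*} [TopologicalSpace X] {f : X → Fin 2 → ℝ}
    (hf : Continuous f) : Continuous fun x => nrm (f x) := by
  unfold nrm
  fun_prop

theorem continuous_sinDist {X : Type*} [TopologicalSpace X] {f g : X → Fin 2 → ℝ}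
    (hf : Continuous f) (hg : Continuous g) (hf0 : ∀ x, f x ≠ 0) (hg0 : ∀ x, g x ≠ 0) :
    Continuous fun x => sinDist (f x) (g x) :=
  (continuous_wedge hf hg).abs.div ((continuous_nrm hf).mul (continuous_nrm hg)) fun x =>
    (mul_pos (nrm_pos (hf0 x)) (nrm_pos (hg0 x))).ne'

theorem sinDist_eq_zero_iff {v w : Fin 2 → ℝ} (hv : v ≠ 0) (hw : w ≠ 0) :
    sinDist v w = 0 ↔ ∃ c : ℝ, c ≠ 0 ∧ c • v = w := by
  constructor
  · intro h
    have h0 : wedge v w = 0 := by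
      have := abs_wedge_eq hv hw
      rwa [h, zero_mul, abs_eq_zero] at this
    have h1 := nrm_sq_smul_eq v w
    have h2 : nrm v ^ 2 ≠ 0 := (pow_pos (nrm_pos hv) 2).ne'
    rw [h0, zero_smul, add_zero] at h1
    have h3 : ((nrm v ^ 2)⁻¹ * (v ⬝ᵥ w)) • v = w := by
      rw [mul_smul, ← h1, smul_smul, inv_mul_cancel₀ h2, one_smul]
    refine ⟨_, ?_, h3⟩
    intro h4
    rw [h4, zero_smul] at h3
    exact hw h3.symm
  · rintro ⟨c, hc, rfl⟩
    rw [sinDist_smul_right hc, sinDist_self]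

/-! ### The projective line, its intervals and multicones -/

theorem dirVec_add_two_pi (θ : ℝ) : dirVec (θ + 2 * Real.pi) = dirVec θ := by
  simp [dirVec]

theorem dirVec_add_pi (θ : ℝ) : dirVec (θ + Real.pi) = (-1 : ℝ) • dirVec θ := by
  ext i
  fin_cases i <;> simp [dirVec]

theorem exists_eq_nrm_smul_dirVec (v : Fin 2 → ℝ) : ∃ θ, v = nrm v • dirVec θ := by
  have hn : nrm v = ‖(⟨v 0, v 1⟩ : ℂ)‖ := by
    rw [nrm, Complex.norm_eq_sqrt_sq_add_sq]
  refine ⟨Complex.arg ⟨v 0, v 1⟩, ?_⟩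
  rw [hn]
  ext i
  fin_cases i
  · simp [dirVec, Complex.norm_mul_cos_arg]
  · simp [dirVec, Complex.norm_mul_sin_arg]

theorem mk_smul_eq {c : ℝ} {v : Fin 2 → ℝ} (hv : v ≠ 0) (h : c • v ≠ 0) :
    mk ℝ (c • v) h = mk ℝ v hv := by
  rw [mk_eq_mk_iff']
  exact ⟨c, rfl⟩

theorem mk_congr {v w : Fin 2 → ℝ} (h : v = w) (hv : v ≠ 0) (hw : w ≠ 0) :
    mk ℝ v hv = mk ℝ w hw := by
  subst h
  rfl

theorem mk_eq_mk_iff_sinDist {v w : Fin 2 → ℝ} (hv : v ≠ 0) (hw : w ≠ 0) :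
    mk ℝ v hv = mk ℝ w hw ↔ sinDist v w = 0 := by
  rw [eq_comm, sinDist_eq_zero_iff hv hw, mk_eq_mk_iff']
  constructor
  · rintro ⟨c, hc⟩
    refine ⟨c, ?_, hc⟩
    rintro rfl
    exact hw (by rw [← hc, zero_smul])
  · rintro ⟨c, -, hc⟩
    exact ⟨c, hc⟩

theorem dir_add_pi (θ : ℝ) : dir (θ + Real.pi) = dir θ := by
  unfold dir
  rw [mk_eq_mk_iff']
  exact ⟨-1, (dirVec_add_pi θ).symm⟩

theorem dir_surjective : Function.Surjective dir := by
  intro x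
  induction x using Projectivization.ind with
  | h v hv =>
    obtain ⟨θ, hθ⟩ := exists_eq_nrm_smul_dirVec v
    refine ⟨θ, ?_⟩
    unfold dir
    rw [eq_comm, mk_eq_mk_iff']
    exact ⟨nrm v, hθ.symm⟩

theorem GL_det_ne_zero (g : GL (Fin 2) ℝ) : (g : Matrix (Fin 2) (Fin 2) ℝ).det ≠ 0 :=
  ((Matrix.isUnit_iff_isUnit_det _).mp g.isUnit).ne_zero

theorem smul_mk_eq (g : GL (Fin 2) ℝ) {v : Fin 2 → ℝ} (hv : v ≠ 0) :
    g • mk ℝ v hv = mk ℝ ((g : Matrix (Fin 2) (Fin 2) ℝ) *ᵥ v)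
      (mulVec_ne_zero (GL_det_ne_zero g) hv) := rfl

/-- The sine of the angle between two lines. -/
noncomputable def lineDist (x y : RP1) : ℝ := sinDist x.rep y.rep

theorem lineDist_mk {v w : Fin 2 → ℝ} (hv : v ≠ 0) (hw : w ≠ 0) :
    lineDist (mk ℝ v hv) (mk ℝ w hw) = sinDist v w := by
  obtain ⟨a, ha⟩ := exists_smul_eq_mk_rep ℝ v hv
  obtain ⟨b, hb⟩ := exists_smul_eq_mk_rep ℝ w hw
  rw [lineDist, ← ha, ← hb, Units.smul_def, Units.smul_def, sinDist_smul_left a.ne_zero,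
    sinDist_smul_right b.ne_zero]

theorem lineDist_dir (a b : ℝ) : lineDist (dir a) (dir b) = |Real.sin (a - b)| := by
  rw [dir, dir, lineDist_mk, sinDist_dirVec]

theorem lineDist_self (x : RP1) : lineDist x x = 0 := sinDist_self _

theorem lineDist_comm (x y : RP1) : lineDist x y = lineDist y x := sinDist_comm _ _

theorem lineDist_nonneg (x y : RP1) : 0 ≤ lineDist x y := sinDist_nonneg _ _

theorem lineDist_eq_zero {x y : RP1} : lineDist x y = 0 ↔ x = y := by
  rw [lineDist, ← mk_eq_mk_iff_sinDist x.rep_nonzero y.rep_nonzero, mk_rep, mk_rep]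

theorem continuous_lineDist_left (y : RP1) : Continuous fun x => lineDist x y := by
  refine continuous_coinduced_dom.mpr ?_
  have : ((fun x => lineDist x y) ∘ mk' ℝ (V := Fin 2 → ℝ)) =
      fun v : { v : Fin 2 → ℝ // v ≠ 0 } => sinDist v y.rep := by
    ext v
    have := lineDist_mk v.2 y.rep_nonzero
    rw [mk_rep] at this
    exact this
  rw [this]
  exact continuous_sinDist continuous_subtype_val continuous_const (fun x => x.2)
    fun _ => y.rep_nonzero

theorem isOpen_lineDist_lt (y : RP1) (ε : ℝ) : IsOpen {x | lineDist x y < ε} :=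
  isOpen_lt (continuous_lineDist_left y) continuous_const

/-- The projective line is Hausdorff: the sine distance separates points. -/
instance instT2SpaceRP1 : T2Space RP1 where
  t2 x y hxy := by
    have hpos : 0 < lineDist x y :=
      lt_of_le_of_ne (lineDist_nonneg x y) fun h => hxy (lineDist_eq_zero.mp h.symm)
    refine ⟨{z | lineDist z x < lineDist z y}, {z | lineDist z y < lineDist z x},
      isOpen_lt (continuous_lineDist_left x) (continuous_lineDist_left y),
      isOpen_lt (continuous_lineDist_left y) (continuous_lineDist_left x), ?_, ?_, ?_⟩
    · simpa [lineDist_self] using hpos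
    · simpa [lineDist_self, lineDist_comm y x] using hpos
    · rw [Set.disjoint_left]
      intro z hz hz'
      have h1 : lineDist z x < lineDist z y := hz
      have h2 : lineDist z y < lineDist z x := hz'
      exact lt_asymm h1 h2

theorem continuous_dirVec : Continuous dirVec := by
  refine continuous_pi fun i => ?_
  fin_cases i
  · exact Real.continuous_cos
  · exact Real.continuous_sin

theorem continuous_dir : Continuous dir := by
  have h : Continuous (mk' ℝ (V := Fin 2 → ℝ)) := continuous_coinduced_rng
  exact h.comp (continuous_dirVec.subtype_mk dirVec_ne_zero)

theorem IsClosedInterval.isCompact {I : Set RP1} (h : IsClosedInterval I) : IsCompact I := by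
  obtain ⟨a, b, -, -, rfl⟩ := h
  exact isCompact_Icc.image continuous_dir

theorem IsMulticone.isClosed {C : Set RP1} (h : IsMulticone C) : IsClosed C := by
  obtain ⟨-, -, F, hF, hI, rfl⟩ := h
  exact (hF.isCompact_sUnion fun I hI' => (hI I hI').isCompact).isClosed

/-- The set of lines spanned by the nonzero nonnegative combinations of two vectors. -/
def coneOf (u w : Fin 2 → ℝ) : Set RP1 :=
  {x | ∃ s t : ℝ, 0 ≤ s ∧ 0 ≤ t ∧ ∃ h : s • u + t • w ≠ 0, x = mk ℝ (s • u + t • w) h}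

theorem coneOf_comm (u w : Fin 2 → ℝ) : coneOf u w = coneOf w u := by
  have key : ∀ u w, coneOf u w ⊆ coneOf w u := by
    rintro u w x ⟨s, t, hs, ht, h, rfl⟩
    exact ⟨t, s, ht, hs, by rwa [add_comm], mk_congr (add_comm _ _) _ _⟩
  exact (key u w).antisymm (key w u)

theorem coneOf_smul_smul {r r' : ℝ} (hr : 0 < r) (hr' : 0 < r') (u w : Fin 2 → ℝ) :
    coneOf (r • u) (r' • w) = coneOf u w := by
  ext x
  constructor
  · rintro ⟨s, t, hs, ht, h, rfl⟩
    have e : s • r • u + t • r' • w = (s * r) • u + (t * r') • w := by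
      rw [smul_smul, smul_smul]
    exact ⟨s * r, t * r', by positivity, by positivity, e ▸ h, mk_congr e _ _⟩
  · rintro ⟨s, t, hs, ht, h, rfl⟩
    have e : s • u + t • w = (s / r) • r • u + (t / r') • r' • w := by
      rw [smul_smul, smul_smul, div_mul_cancel₀ _ hr.ne', div_mul_cancel₀ _ hr'.ne']
    exact ⟨s / r, t / r', by positivity, by positivity, e ▸ h, mk_congr e _ _⟩

theorem imageCone_coneOf (g : GL (Fin 2) ℝ) (u w : Fin 2 → ℝ) :
    imageCone g (coneOf u w) = coneOf ((g : Matrix (Fin 2) (Fin 2) ℝ) *ᵥ u)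
      ((g : Matrix (Fin 2) (Fin 2) ℝ) *ᵥ w) := by
  have e : ∀ s t : ℝ, (g : Matrix (Fin 2) (Fin 2) ℝ) *ᵥ (s • u + t • w) =
      s • ((g : Matrix (Fin 2) (Fin 2) ℝ) *ᵥ u) + t • ((g : Matrix (Fin 2) (Fin 2) ℝ) *ᵥ w) := by
    intro s t
    rw [Matrix.mulVec_add, Matrix.mulVec_smul, Matrix.mulVec_smul]
  ext x
  constructor
  · rintro ⟨_, ⟨s, t, hs, ht, h, rfl⟩, rfl⟩
    refine ⟨s, t, hs, ht, ?_, ?_⟩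
    · rw [← e]
      exact mulVec_ne_zero (GL_det_ne_zero g) h
    · exact (smul_mk_eq g h).trans (mk_congr (e s t) _ _)
  · rintro ⟨s, t, hs, ht, h, rfl⟩
    have h' : s • u + t • w ≠ 0 := by
      intro h0
      rw [← e, h0, Matrix.mulVec_zero] at h
      exact h rfl
    exact ⟨_, ⟨s, t, hs, ht, h', rfl⟩, (smul_mk_eq g h').trans (mk_congr (e s t) _ _)⟩

theorem sin_smul_dirVec (a b θ : ℝ) :
    Real.sin (b - a) • dirVec θ = Real.sin (b - θ) • dirVec a + Real.sin (θ - a) • dirVec b := by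
  ext i
  fin_cases i
  · simp only [dirVec, Real.sin_sub, Fin.zero_eta, Fin.isValue, Pi.smul_apply, Pi.add_apply,
      Matrix.cons_val_zero, smul_eq_mul]
    ring
  · simp only [dirVec, Real.sin_sub, Fin.mk_one, Fin.isValue, Pi.smul_apply, Pi.add_apply,
      Matrix.cons_val_one, Matrix.cons_val_zero, smul_eq_mul]
    ring

/-- A projective interval is the projectivization of a planar convex cone. -/
theorem image_Icc_eq_coneOf {a b : ℝ} (hab : a < b) (hba : b < a + Real.pi) :
    dir '' Icc a b = coneOf (dirVec a) (dirVec b) := by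
  have hs : 0 < Real.sin (b - a) := Real.sin_pos_of_pos_of_lt_pi (by linarith) (by linarith)
  ext x
  constructor
  · rintro ⟨θ, ⟨h1, h2⟩, rfl⟩
    have h0 : Real.sin (b - a) • dirVec θ ≠ 0 := smul_ne_zero hs.ne' (dirVec_ne_zero θ)
    refine ⟨Real.sin (b - θ), Real.sin (θ - a),
      Real.sin_nonneg_of_nonneg_of_le_pi (by linarith) (by linarith),
      Real.sin_nonneg_of_nonneg_of_le_pi (by linarith) (by linarith), ?_, ?_⟩
    · rwa [← sin_smul_dirVec]
    · exact (mk_smul_eq (dirVec_ne_zero θ) h0).symm.trans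
        (mk_congr (sin_smul_dirVec a b θ) _ _)
  · rintro ⟨s, t, hs0, ht0, h, rfl⟩
    -- the angle at which the ratio of the two sine coefficients is `s : t`
    obtain ⟨θ, hθ, hz⟩ : ∃ θ ∈ Icc a b, t * Real.sin (b - θ) - s * Real.sin (θ - a) = 0 := by
      have hc : ContinuousOn (fun θ => t * Real.sin (b - θ) - s * Real.sin (θ - a)) (Icc a b) := by
        fun_prop
      have := intermediate_value_Icc' hab.le hc
      refine this ⟨?_, ?_⟩
      · simp only [sub_self, Real.sin_zero, mul_zero, zero_sub]
        nlinarith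
      · simp only [sub_self, Real.sin_zero, mul_zero, sub_zero]
        positivity
    refine ⟨θ, hθ, ?_⟩
    unfold dir
    rw [mk_eq_mk_iff_sinDist, sinDist]
    have : wedge (dirVec θ) (s • dirVec a + t • dirVec b) = 0 := by
      have e1 := wedge_dirVec θ a
      have e2 := wedge_dirVec θ b
      have e3 : wedge (dirVec θ) (s • dirVec a + t • dirVec b) =
          s * wedge (dirVec θ) (dirVec a) + t * wedge (dirVec θ) (dirVec b) := by
        simp [wedge]
        ring
      rw [e3, e1, e2, ← neg_sub θ a, Real.sin_neg]
      linarith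
    rw [this, abs_zero, zero_div]

theorem isClosedInterval_coneOf_of_pos {u w : Fin 2 → ℝ} (h : 0 < wedge u w) :
    IsClosedInterval (coneOf u w) := by
  obtain ⟨a, ha⟩ := exists_eq_nrm_smul_dirVec u
  obtain ⟨b₀, hb₀⟩ := exists_eq_nrm_smul_dirVec w
  obtain ⟨b, ⟨hab, hba⟩, hb⟩ : ∃ b ∈ Ico a (a + 2 * Real.pi), w = nrm w • dirVec b := by
    have hp : Function.Periodic dirVec (2 * Real.pi) := dirVec_add_two_pi
    refine ⟨toIcoMod Real.two_pi_pos a b₀, toIcoMod_mem_Ico _ _ _, ?_⟩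
    rw [toIcoMod, hp.sub_zsmul_eq, ← hb₀]
  have hu : 0 < nrm u := nrm_pos fun h0 => by simp [h0, wedge] at h
  have hw : 0 < nrm w := nrm_pos fun h0 => by simp [h0, wedge] at h
  have hsin : 0 < Real.sin (b - a) := by
    rw [ha, hb, wedge_smul_left, wedge_smul_right, wedge_dirVec] at h
    exact (pos_iff_pos_of_mul_pos (pos_of_mul_pos_right h hu.le : 0 < nrm w * _)).mp hw
  have hba' : b - a < Real.pi := by
    by_contra! hcon
    have := Real.sin_nonpos_of_nonpos_of_neg_pi_le (x := b - a - 2 * Real.pi) (by linarith)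
      (by linarith)
    rw [Real.sin_sub_two_pi] at this
    linarith
  have hab' : a < b := lt_of_le_of_ne hab fun h0 => by simp [h0] at hsin
  refine ⟨a, b, hab', by linarith, ?_⟩
  rw [image_Icc_eq_coneOf hab' (by linarith), ha, hb]
  conv_rhs => rw [← coneOf_smul_smul hu hw]

theorem isClosedInterval_coneOf {u w : Fin 2 → ℝ} (h : wedge u w ≠ 0) :
    IsClosedInterval (coneOf u w) := by
  rcases lt_or_gt_of_ne h with h | h
  · rw [coneOf_comm]
    refine isClosedInterval_coneOf_of_pos ?_
    rw [wedge_swap]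
    linarith
  · exact isClosedInterval_coneOf_of_pos h

theorem IsClosedInterval.imageCone {I : Set RP1} (h : IsClosedInterval I) (g : GL (Fin 2) ℝ) :
    IsClosedInterval (imageCone g I) := by
  obtain ⟨a, b, hab, hba, rfl⟩ := h
  rw [image_Icc_eq_coneOf hab hba, imageCone_coneOf]
  refine isClosedInterval_coneOf ?_
  rw [wedge_mulVec, wedge_dirVec]
  exact mul_ne_zero (GL_det_ne_zero g)
    (Real.sin_pos_of_pos_of_lt_pi (by linarith) (by linarith)).ne'

theorem IsMulticone.imageCone {C : Set RP1} (h : IsMulticone C) (g : GL (Fin 2) ℝ) :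
    IsMulticone (imageCone g C) := by
  obtain ⟨hne, huniv, F, hF, hI, rfl⟩ := h
  refine ⟨hne.image _, ?_, (fun I => PlanarCocycle.imageCone g I) '' F, hF.image _, ?_, ?_⟩
  · intro h0
    refine huniv (eq_univ_of_forall fun x => ?_)
    have : g • x ∈ PlanarCocycle.imageCone g (⋃₀ F) := h0 ▸ mem_univ _
    obtain ⟨y, hy, hyx⟩ := this
    rwa [← MulAction.injective g hyx]
  · rintro _ ⟨I, hIF, rfl⟩
    exact (hI I hIF).imageCone g
  · unfold PlanarCocycle.imageCone
    rw [sUnion_eq_biUnion, image_iUnion₂, sUnion_image]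

/-- Invertible matrices act on the projective line by homeomorphisms. -/
theorem continuous_smul_RP1 (g : GL (Fin 2) ℝ) : Continuous fun x : RP1 => g • x := by
  refine continuous_coinduced_dom.mpr ?_
  have h : Continuous (mk' ℝ (V := Fin 2 → ℝ)) := continuous_coinduced_rng
  have h2 : Continuous fun v : { v : Fin 2 → ℝ // v ≠ 0 } =>
      (⟨(g : Matrix (Fin 2) (Fin 2) ℝ) *ᵥ v, mulVec_ne_zero (GL_det_ne_zero g) v.2⟩ :
        { v : Fin 2 → ℝ // v ≠ 0 }) := by
    refine Continuous.subtype_mk ?_ _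
    exact Continuous.matrix_mulVec continuous_const continuous_subtype_val
  exact h.comp h2

theorem imageCone_eq_preimage (g : GL (Fin 2) ℝ) (C : Set RP1) :
    imageCone g C = (fun x : RP1 => g⁻¹ • x) ⁻¹' C := by
  ext x
  constructor
  · rintro ⟨y, hy, rfl⟩
    simpa using hy
  · intro hx
    exact ⟨g⁻¹ • x, hx, smul_inv_smul g x⟩

theorem imageCone_interior_subset (g : GL (Fin 2) ℝ) (C : Set RP1) :
    imageCone g (interior C) ⊆ interior (imageCone g C) := by
  refine interior_maximal (image_mono interior_subset) ?_
  rw [imageCone_eq_preimage]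
  exact isOpen_interior.preimage (continuous_smul_RP1 _)

theorem imageCone_mul (g h : GL (Fin 2) ℝ) (C : Set RP1) :
    imageCone (g * h) C = imageCone g (imageCone h C) := by
  unfold imageCone
  rw [image_image]
  simp [mul_smul]

/-! ### From an invariant multicone to almost multiplicativity -/

theorem exists_pos_forall_of_finite {α : Type*} {s : Set α} (hs : s.Finite) {P : α → ℝ → Prop}
    (hP : ∀ a δ δ', δ' ≤ δ → P a δ → P a δ') (h : ∀ a ∈ s, ∃ δ > 0, P a δ) :
    ∃ δ > 0, ∀ a ∈ s, P a δ := by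
  induction s, hs using Set.Finite.induction_on with
  | empty => exact ⟨1, one_pos, by simp⟩
  | @insert a s _ _ ih =>
    obtain ⟨δ, hδ, h1⟩ := ih fun b hb => h b (mem_insert_of_mem _ hb)
    obtain ⟨δ', hδ', h2⟩ := h a (mem_insert _ _)
    refine ⟨min δ δ', lt_min hδ hδ', ?_⟩
    rintro b (rfl | hb)
    · exact hP _ _ _ (min_le_right _ _) h2
    · exact hP _ _ _ (min_le_left _ _) (h1 b hb)

theorem exists_mem_Ico_dir_eq (a : ℝ) (x : RP1) : ∃ θ ∈ Ico a (a + Real.pi), dir θ = x := by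
  obtain ⟨θ, rfl⟩ := dir_surjective x
  have hp : Function.Periodic dir Real.pi := dir_add_pi
  refine ⟨toIcoMod Real.pi_pos a θ, toIcoMod_mem_Ico Real.pi_pos a θ, ?_⟩
  rw [toIcoMod, hp.sub_zsmul_eq]

/-- Disjoint closed subsets of the (compact) projective line lie at positive distance. -/
theorem exists_pos_le_lineDist {K L : Set RP1} (hK : IsClosed K) (hL : IsClosed L)
    (hKL : Disjoint K L) : ∃ δ > 0, ∀ x ∈ K, ∀ y ∈ L, δ ≤ lineDist x y := by
  have hdir : ∀ x, ∃ θ ∈ Icc 0 Real.pi, dir θ = x := fun x => by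
    obtain ⟨θ, hθ, h⟩ := exists_mem_Ico_dir_eq 0 x
    rw [zero_add] at hθ
    exact ⟨θ, Ico_subset_Icc_self hθ, h⟩
  have hA : IsCompact (Icc 0 Real.pi ∩ dir ⁻¹' K) :=
    isCompact_Icc.inter_right (hK.preimage continuous_dir)
  have hB : IsCompact (Icc 0 Real.pi ∩ dir ⁻¹' L) :=
    isCompact_Icc.inter_right (hL.preimage continuous_dir)
  rcases ((Icc 0 Real.pi ∩ dir ⁻¹' K) ×ˢ (Icc 0 Real.pi ∩ dir ⁻¹' L)).eq_empty_or_nonempty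
    with he | hne
  · refine ⟨1, one_pos, fun x hx y hy => ?_⟩
    obtain ⟨a, ha, rfl⟩ := hdir x
    obtain ⟨b, hb, rfl⟩ := hdir y
    have : (a, b) ∈ (Icc 0 Real.pi ∩ dir ⁻¹' K) ×ˢ (Icc 0 Real.pi ∩ dir ⁻¹' L) :=
      ⟨⟨ha, hx⟩, ⟨hb, hy⟩⟩
    rw [he] at this
    exact this.elim
  · have hc : ContinuousOn (fun p : ℝ × ℝ => |Real.sin (p.1 - p.2)|)
        ((Icc 0 Real.pi ∩ dir ⁻¹' K) ×ˢ (Icc 0 Real.pi ∩ dir ⁻¹' L)) := by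
      fun_prop
    obtain ⟨⟨a, b⟩, hab, hmin⟩ := (hA.prod hB).exists_isMinOn hne hc
    refine ⟨lineDist (dir a) (dir b), ?_, fun x hx y hy => ?_⟩
    · refine lt_of_le_of_ne (lineDist_nonneg _ _) fun h => ?_
      have h1 := lineDist_eq_zero.mp h.symm
      have h2 : dir a ∈ K := hab.1.2
      have h3 : dir b ∈ L := hab.2.2
      exact disjoint_left.mp hKL h2 (h1 ▸ h3)
    · obtain ⟨a', ha', rfl⟩ := hdir x
      obtain ⟨b', hb', rfl⟩ := hdir y
      have := hmin (show (a', b') ∈ (Icc 0 Real.pi ∩ dir ⁻¹' K) ×ˢ (Icc 0 Real.pi ∩ dir ⁻¹' L) from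
        ⟨⟨ha', hx⟩, ⟨hb', hy⟩⟩)
      rw [lineDist_dir, lineDist_dir]
      exact this

theorem exists_dir_mem_sin_ne_zero {U : Set RP1} (hU : IsOpen U) (hne : U.Nonempty) :
    ∃ a b, dir a ∈ U ∧ dir b ∈ U ∧ Real.sin (b - a) ≠ 0 := by
  obtain ⟨x, hx⟩ := hne
  obtain ⟨a, rfl⟩ := dir_surjective x
  obtain ⟨ε, hε, hball⟩ := Metric.isOpen_iff.mp (hU.preimage continuous_dir) a hx
  have hm : 0 < min (ε / 2) 1 := lt_min (by positivity) one_pos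
  refine ⟨a, a + min (ε / 2) 1, hx, hball ?_, ?_⟩
  · rw [Metric.mem_ball, Real.dist_eq, add_sub_cancel_left, abs_of_pos hm]
    exact lt_of_le_of_lt (min_le_left _ _) (by linarith)
  · rw [add_sub_cancel_left]
    refine (Real.sin_pos_of_pos_of_lt_pi hm ?_).ne'
    have := min_le_right (ε / 2) 1
    linarith [Real.pi_gt_three]

theorem mulVec_inv_mulVec {g : Matrix (Fin 2) (Fin 2) ℝ} (hg : g.det ≠ 0) (v : Fin 2 → ℝ) :
    g *ᵥ (g⁻¹ *ᵥ v) = v := by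
  rw [Matrix.mulVec_mulVec, Matrix.mul_nonsing_inv _ (isUnit_iff_ne_zero.mpr hg),
    Matrix.one_mulVec]

theorem inv_mulVec_mulVec {g : Matrix (Fin 2) (Fin 2) ℝ} (hg : g.det ≠ 0) (v : Fin 2 → ℝ) :
    g⁻¹ *ᵥ (g *ᵥ v) = v := by
  rw [Matrix.mulVec_mulVec, Matrix.nonsing_inv_mul _ (isUnit_iff_ne_zero.mpr hg),
    Matrix.one_mulVec]

theorem norm_le_abs_det_mul {g : Matrix (Fin 2) (Fin 2) ℝ} (hg : g.det ≠ 0) :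
    ‖g‖ ≤ |g.det| * ‖g⁻¹‖ := by
  have hu := isUnit_iff_ne_zero.mpr hg
  have hdet : (g⁻¹).det = (g.det)⁻¹ := by
    rw [Matrix.det_nonsing_inv, Ring.inverse_eq_inv']
  have h := abs_det_mul_norm_inv (g := g⁻¹) (by rw [hdet]; exact inv_ne_zero hg)
  rw [hdet, Matrix.nonsing_inv_nonsing_inv _ hu, abs_inv,
    inv_mul_le_iff₀ (abs_pos.mpr hg)] at h
  exact h

/-- If two transverse vectors are pulled back by `g` to directions far from that of `v`, then `g`
expands `v` almost as much as possible: comparing areas,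
`|g v| |p| ≥ |g v ∧ p| = |det g| |v ∧ g⁻¹ p|`, and `|det g| ‖g⁻¹‖ = ‖g‖` in the plane. -/
theorem mul_norm_mul_nrm_le_of_sinDist {g : Matrix (Fin 2) (Fin 2) ℝ} (hg : g.det ≠ 0)
    {v p q : Fin 2 → ℝ} (hv : v ≠ 0) (hp : nrm p = 1) (hq : nrm q = 1) {δ : ℝ} (hδ : 0 ≤ δ)
    (hvp : δ ≤ sinDist v (g⁻¹ *ᵥ p)) (hvq : δ ≤ sinDist v (g⁻¹ *ᵥ q)) :
    δ * |wedge p q| / 2 * ‖g‖ * nrm v ≤ nrm (g *ᵥ v) := by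
  have hinv : (g⁻¹).det ≠ 0 := by
    rw [Matrix.det_nonsing_inv, Ring.inverse_eq_inv']
    exact inv_ne_zero hg
  have key : ∀ r, nrm r = 1 → δ ≤ sinDist v (g⁻¹ *ᵥ r) →
      |g.det| * (δ * (nrm v * nrm (g⁻¹ *ᵥ r))) ≤ nrm (g *ᵥ v) := by
    intro r hr hvr
    have hr0 : r ≠ 0 := by
      rintro rfl
      rw [nrm_zero] at hr
      exact zero_ne_one hr
    have h1 := abs_wedge_le (g *ᵥ v) r
    rw [hr, mul_one] at h1
    refine le_trans ?_ h1
    conv_rhs => rw [← mulVec_inv_mulVec hg r]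
    rw [wedge_mulVec, abs_mul, abs_wedge_eq hv (mulVec_ne_zero hinv hr0)]
    have := mul_nonneg (nrm_nonneg v) (nrm_nonneg (g⁻¹ *ᵥ r))
    gcongr
  have h1 := key p hp hvp
  have h2 := key q hq hvq
  have h3 : |wedge p q| * ‖g⁻¹‖ ≤ nrm (g⁻¹ *ᵥ p) + nrm (g⁻¹ *ᵥ q) := by
    have h5 : ∀ x, |wedge p q| * nrm (g⁻¹ *ᵥ x) ≤
        (nrm (g⁻¹ *ᵥ p) + nrm (g⁻¹ *ᵥ q)) * nrm x := by
      intro x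
      have e : wedge p q • x = wedge x q • p + wedge p x • q := by
        ext i
        fin_cases i <;> simp [wedge] <;> ring
      rw [← nrm_smul, ← Matrix.mulVec_smul, e, Matrix.mulVec_add, Matrix.mulVec_smul,
        Matrix.mulVec_smul]
      refine (nrm_add_le _ _).trans ?_
      rw [nrm_smul, nrm_smul]
      have h6 := abs_wedge_le x q
      have h7 := abs_wedge_le p x
      rw [hq, mul_one] at h6
      rw [hp, one_mul] at h7
      nlinarith [mul_le_mul_of_nonneg_right h6 (nrm_nonneg (g⁻¹ *ᵥ p)),
        mul_le_mul_of_nonneg_right h7 (nrm_nonneg (g⁻¹ *ᵥ q))]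
    rcases (abs_nonneg (wedge p q)).eq_or_lt with h0 | h0
    · rw [← h0, zero_mul]
      exact add_nonneg (nrm_nonneg _) (nrm_nonneg _)
    · rw [← le_div_iff₀' h0]
      refine norm_le_of_nrm_mulVec_le
        (div_nonneg (add_nonneg (nrm_nonneg _) (nrm_nonneg _)) h0.le) fun x => ?_
      rw [div_mul_eq_mul_div, le_div_iff₀' h0]
      exact h5 x
  have h4 := norm_le_abs_det_mul hg
  have h5 : 0 ≤ δ * nrm v := mul_nonneg hδ (nrm_nonneg v)
  calc δ * |wedge p q| / 2 * ‖g‖ * nrm v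
      = δ * nrm v * (|wedge p q| * ‖g‖) / 2 := by ring
    _ ≤ δ * nrm v * (|wedge p q| * (|g.det| * ‖g⁻¹‖)) / 2 := by gcongr
    _ = δ * nrm v * (|g.det| * (|wedge p q| * ‖g⁻¹‖)) / 2 := by ring
    _ ≤ δ * nrm v * (|g.det| * (nrm (g⁻¹ *ᵥ p) + nrm (g⁻¹ *ᵥ q))) / 2 := by gcongr
    _ ≤ nrm (g *ᵥ v) := by linarith

theorem mul_norm_le_of_forall_nrm {h : Matrix (Fin 2) (Fin 2) ℝ} {a b : ℝ} (ha : 0 < a)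
    (hb : 0 ≤ b) (H : ∀ v, a * nrm (h *ᵥ v) ≤ b * nrm v) : a * ‖h‖ ≤ b := by
  rw [← le_div_iff₀' ha]
  refine norm_le_of_nrm_mulVec_le (by positivity) fun v => ?_
  rw [div_mul_eq_mul_div, le_div_iff₀' ha]
  exact H v

/-- `g` is a similarity for the norm `v ↦ |M v|`. -/
def IsSimilarity (M g : Matrix (Fin 2) (Fin 2) ℝ) : Prop :=
  ∃ ρ : ℝ, 0 < ρ ∧ ∀ v, nrm (M *ᵥ (g *ᵥ v)) = ρ * nrm (M *ᵥ v)

theorem IsSimilarity.mul {M g h : Matrix (Fin 2) (Fin 2) ℝ} (hg : IsSimilarity M g)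
    (hh : IsSimilarity M h) : IsSimilarity M (g * h) := by
  obtain ⟨ρ, hρ, h1⟩ := hg
  obtain ⟨ρ', hρ', h2⟩ := hh
  refine ⟨ρ * ρ', mul_pos hρ hρ', fun v => ?_⟩
  rw [← Matrix.mulVec_mulVec, h1, h2, mul_assoc]

/-- Similarities for a fixed Euclidean structure distort all vectors equally, up to a constant. -/
theorem IsSimilarity.mul_norm_mul_nrm_le {M g : Matrix (Fin 2) (Fin 2) ℝ} (hM : M.det ≠ 0)
    (hg : IsSimilarity M g) (v : Fin 2 → ℝ) :
    ((‖M‖ * ‖M⁻¹‖) ^ 2)⁻¹ * ‖g‖ * nrm v ≤ nrm (g *ᵥ v) := by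
  obtain ⟨ρ, hρ, h⟩ := hg
  have hinv : ∀ u, nrm u ≤ ‖M⁻¹‖ * nrm (M *ᵥ u) := fun u => by
    have := nrm_mulVec_le M⁻¹ (M *ᵥ u)
    rwa [inv_mulVec_mulVec hM] at this
  have h0 : 0 < ‖M‖ := by
    rw [norm_pos_iff]
    rintro rfl
    simp at hM
  have h0' : 0 < ‖M⁻¹‖ := by
    have := norm_le_abs_det_mul hM
    by_contra! hcon
    nlinarith [abs_nonneg M.det]
  have hnorm : ‖g‖ ≤ ‖M⁻¹‖ * (ρ * ‖M‖) := by
    refine norm_le_of_nrm_mulVec_le (by positivity) fun u => ?_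
    calc nrm (g *ᵥ u) ≤ ‖M⁻¹‖ * nrm (M *ᵥ (g *ᵥ u)) := hinv _
      _ = ‖M⁻¹‖ * (ρ * nrm (M *ᵥ u)) := by rw [h]
      _ ≤ ‖M⁻¹‖ * (ρ * (‖M‖ * nrm u)) := by
          gcongr
          exact nrm_mulVec_le _ _
      _ = ‖M⁻¹‖ * (ρ * ‖M‖) * nrm u := by ring
  rw [mul_assoc, inv_mul_le_iff₀ (by positivity)]
  have hv := nrm_nonneg v
  calc ‖g‖ * nrm v ≤ ‖M⁻¹‖ * (ρ * ‖M‖) * (‖M⁻¹‖ * nrm (M *ᵥ v)) := by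
        gcongr
        exact hinv v
    _ = ‖M⁻¹‖ * ‖M‖ * ‖M⁻¹‖ * nrm (M *ᵥ (g *ᵥ v)) := by rw [h]; ring
    _ ≤ ‖M⁻¹‖ * ‖M‖ * ‖M⁻¹‖ * (‖M‖ * nrm (g *ᵥ v)) := by
        gcongr
        exact nrm_mulVec_le _ _
    _ = (‖M‖ * ‖M⁻¹‖) ^ 2 * nrm (g *ᵥ v) := by ring

theorem nrm_mulVec_of_mem_orthogonalGroup {U : Matrix (Fin 2) (Fin 2) ℝ}
    (hU : U ∈ Matrix.orthogonalGroup (Fin 2) ℝ) (v : Fin 2 → ℝ) : nrm (U *ᵥ v) = nrm v := by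
  have h := (Matrix.mem_orthogonalGroup_iff' (Fin 2) ℝ).mp hU
  have e : ∀ w : Fin 2 → ℝ, nrm w ^ 2 = w ⬝ᵥ w := fun w => by
    rw [nrm_sq]
    simp [dotProduct, Fin.sum_univ_two, sq]
  refine (sq_eq_sq₀ (nrm_nonneg _) (nrm_nonneg _)).mp ?_
  have h' : Uᵀ * U = 1 := h
  rw [e, e, Matrix.dotProduct_mulVec, Matrix.vecMul_mulVec, h', Matrix.vecMul_one]

theorem isSimilarity_of_mem_orthogonalGroup {M g : GL (Fin 2) ℝ} {r : ℝ} (hr : 0 < r)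
    (h : r • ((M * g * M⁻¹ : GL (Fin 2) ℝ) : Matrix (Fin 2) (Fin 2) ℝ) ∈
      Matrix.orthogonalGroup (Fin 2) ℝ) :
    IsSimilarity (M : Matrix (Fin 2) (Fin 2) ℝ) (g : Matrix (Fin 2) (Fin 2) ℝ) := by
  refine ⟨r⁻¹, inv_pos.mpr hr, fun v => ?_⟩
  have h1 := nrm_mulVec_of_mem_orthogonalGroup h ((M : Matrix (Fin 2) (Fin 2) ℝ) *ᵥ v)
  have h2 : ((M * g * M⁻¹ : GL (Fin 2) ℝ) : Matrix (Fin 2) (Fin 2) ℝ) *ᵥ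
      ((M : Matrix (Fin 2) (Fin 2) ℝ) *ᵥ v) =
      (M : Matrix (Fin 2) (Fin 2) ℝ) *ᵥ ((g : Matrix (Fin 2) (Fin 2) ℝ) *ᵥ v) := by
    rw [Matrix.mulVec_mulVec, Matrix.mulVec_mulVec, ← Units.val_mul, ← Units.val_mul,
      inv_mul_cancel_right]
  rw [Matrix.smul_mulVec, nrm_smul, h2, abs_of_pos hr] at h1
  rw [← h1]
  field_simp

theorem StronglyConformal.exists_isSimilarity {A : Set (GL (Fin 2) ℝ)} (h : StronglyConformal A) :
    ∃ M : GL (Fin 2) ℝ, ∀ g ∈ A,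
      IsSimilarity (M : Matrix (Fin 2) (Fin 2) ℝ) (g : Matrix (Fin 2) (Fin 2) ℝ) := by
  obtain ⟨M, hM⟩ := h
  refine ⟨M, fun g hg => isSimilarity_of_mem_orthogonalGroup ?_ (hM g hg)⟩
  exact Real.rpow_pos_of_pos (abs_pos.mpr (GL_det_ne_zero g)) _

/-- Matrices that preserve a multicone expand uniformly all the vectors in the images of the
multicone under finitely many matrices that contract it strictly. -/
theorem IsStronglyInvariantMulticone.exists_expansion {C : Set RP1} {Ah : Set (GL (Fin 2) ℝ)}
    (hAh : Ah.Finite) (hC : IsStronglyInvariantMulticone C Ah) :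
    ∃ c > 0, ∀ g : GL (Fin 2) ℝ, imageCone g C ⊆ C → ∀ H ∈ Ah, ∀ v (hv : v ≠ 0),
      mk ℝ v hv ∈ imageCone H C →
      c * ‖(g : Matrix (Fin 2) (Fin 2) ℝ)‖ * nrm v ≤
        nrm ((g : Matrix (Fin 2) (Fin 2) ℝ) *ᵥ v) := by
  obtain ⟨hm, hint⟩ := hC
  obtain ⟨δ, hδ, hsep⟩ : ∃ δ > 0, ∀ H ∈ Ah, ∀ x ∈ imageCone H C, ∀ y ∈ (interior C)ᶜ,
      δ ≤ lineDist x y := by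
    refine exists_pos_forall_of_finite hAh
      (P := fun H δ => ∀ x ∈ imageCone H C, ∀ y ∈ (interior C)ᶜ, δ ≤ lineDist x y)
      (fun H δ δ' hδ' h x hx y hy => hδ'.trans (h x hx y hy)) fun H hH => ?_
    refine exists_pos_le_lineDist ?_ isOpen_interior.isClosed_compl ?_
    · rw [imageCone_eq_preimage]
      exact hm.isClosed.preimage (continuous_smul_RP1 _)
    · exact disjoint_compl_right_iff_subset.mpr (hint H hH)
  obtain ⟨a, b, ha, hb, hab⟩ := exists_dir_mem_sin_ne_zero hm.isClosed.isOpen_compl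
    (nonempty_compl.mpr hm.2.1)
  refine ⟨δ * |wedge (dirVec a) (dirVec b)| / 2, ?_, ?_⟩
  · rw [wedge_dirVec]
    have := abs_pos.mpr hab
    positivity
  · intro g hg H hH v hv hvH
    have hfar : ∀ θ, dir θ ∈ Cᶜ →
        δ ≤ sinDist v ((g : Matrix (Fin 2) (Fin 2) ℝ)⁻¹ *ᵥ dirVec θ) := by
      intro θ hθ
      have hn : g⁻¹ • dir θ ∈ (interior C)ᶜ := fun hin =>
        hθ (hg ⟨g⁻¹ • dir θ, interior_subset hin, smul_inv_smul g _⟩)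
      have h1 := hsep H hH _ hvH _ hn
      rw [dir, smul_mk_eq, lineDist_mk] at h1
      rwa [Matrix.coe_units_inv] at h1
    exact mul_norm_mul_nrm_le_of_sinDist (GL_det_ne_zero g) hv (nrm_dirVec a) (nrm_dirVec b) hδ.le
      (hfar a ha) (hfar b hb)

theorem norm_GL_pos (g : GL (Fin 2) ℝ) : 0 < ‖(g : Matrix (Fin 2) (Fin 2) ℝ)‖ :=
  norm_pos_iff.mpr g.ne_zero

theorem IsSimilarity.mul_norm_le_norm_mul_of_right {M : Matrix (Fin 2) (Fin 2) ℝ} (hM : M.det ≠ 0)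
    {g h : GL (Fin 2) ℝ} (hh : IsSimilarity M (h : Matrix (Fin 2) (Fin 2) ℝ)) :
    ((‖M‖ * ‖M⁻¹‖) ^ 2)⁻¹ * ‖(g : Matrix (Fin 2) (Fin 2) ℝ)‖ * ‖(h : Matrix (Fin 2) (Fin 2) ℝ)‖ ≤
      ‖((g * h : GL (Fin 2) ℝ) : Matrix (Fin 2) (Fin 2) ℝ)‖ := by
  have h0 := norm_GL_pos h
  rcases (show 0 ≤ ((‖M‖ * ‖M⁻¹‖) ^ 2)⁻¹ by positivity).eq_or_lt with hz | hpos
  · rw [← hz, zero_mul, zero_mul]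
    exact norm_nonneg _
  rw [mul_right_comm]
  refine mul_norm_le_of_forall_nrm (by positivity) (norm_nonneg _) fun v => ?_
  obtain ⟨u, rfl⟩ : ∃ u, (h : Matrix (Fin 2) (Fin 2) ℝ) *ᵥ u = v :=
    ⟨_, mulVec_inv_mulVec (GL_det_ne_zero h) v⟩
  have h1 := hh.mul_norm_mul_nrm_le hM u
  have h2 := nrm_mulVec_le ((g * h : GL (Fin 2) ℝ) : Matrix (Fin 2) (Fin 2) ℝ) u
  rw [Units.val_mul, ← Matrix.mulVec_mulVec] at h2
  calc ((‖M‖ * ‖M⁻¹‖) ^ 2)⁻¹ * ‖(h : Matrix (Fin 2) (Fin 2) ℝ)‖ * nrm (_ *ᵥ (_ *ᵥ u))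
      ≤ ((‖M‖ * ‖M⁻¹‖) ^ 2)⁻¹ * ‖(h : Matrix (Fin 2) (Fin 2) ℝ)‖ *
        (‖((g * h : GL (Fin 2) ℝ) : Matrix (Fin 2) (Fin 2) ℝ)‖ * nrm u) := by
        rw [Units.val_mul]
        gcongr
    _ = ‖((g * h : GL (Fin 2) ℝ) : Matrix (Fin 2) (Fin 2) ℝ)‖ *
        (((‖M‖ * ‖M⁻¹‖) ^ 2)⁻¹ * ‖(h : Matrix (Fin 2) (Fin 2) ℝ)‖ * nrm u) := by ring
    _ ≤ _ := by gcongr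

theorem imageCone_mul_subset {g h : GL (Fin 2) ℝ} {C : Set RP1} (hg : imageCone g C ⊆ C)
    (hh : imageCone h C ⊆ C) : imageCone (g * h) C ⊆ C := by
  rw [imageCone_mul]
  exact (image_mono hh).trans hg

theorem almostMultiplicative_of_multicone {Ae Ah : Set (GL (Fin 2) ℝ)} (hAh : Ah.Finite)
    (he : StronglyConformal Ae)
    (hh : Ah.Nonempty → ∃ C : Set RP1, IsStronglyInvariantMulticone C Ah ∧
      ∀ g ∈ Ae, imageCone g C = C) :
    AlmostMultiplicative (Subsemigroup.closure (Ae ∪ Ah)) := by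
  obtain ⟨M, hM⟩ := he.exists_isSimilarity
  have hMdet := GL_det_ne_zero M
  set m : Matrix (Fin 2) (Fin 2) ℝ := (M : Matrix (Fin 2) (Fin 2) ℝ) with hm
  have hk : 0 < ((‖m‖ * ‖m⁻¹‖) ^ 2)⁻¹ := by
    have h1 := norm_GL_pos M
    have h2 := norm_GL_pos M⁻¹
    rw [Matrix.coe_units_inv] at h2
    positivity
  set k : ℝ := ((‖m‖ * ‖m⁻¹‖) ^ 2)⁻¹ with hk_def
  rcases Ah.eq_empty_or_nonempty with rfl | hne
  · refine ⟨k, hk, fun g _ h hh => ?_⟩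
    rw [union_empty] at hh
    have : IsSimilarity m (h : Matrix (Fin 2) (Fin 2) ℝ) := by
      induction hh using Subsemigroup.closure_induction with
      | mem x hx => exact hM x hx
      | mul x y _ _ hx hy => exact hx.mul hy
    exact this.mul_norm_le_norm_mul_of_right hMdet
  obtain ⟨C, hC, hCe⟩ := hh hne
  obtain ⟨c, hc, hexp⟩ := hC.exists_expansion hAh
  -- the normal form of a word: similarities only, or a first strictly contracting letter
  have hword : ∀ g ∈ Subsemigroup.closure (Ae ∪ Ah), imageCone g C ⊆ C ∧
      (IsSimilarity m (g : Matrix (Fin 2) (Fin 2) ℝ) ∨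
        ∃ E H B : GL (Fin 2) ℝ, IsSimilarity m (E : Matrix (Fin 2) (Fin 2) ℝ) ∧
          imageCone E C ⊆ C ∧ H ∈ Ah ∧ imageCone B C ⊆ C ∧ g = E * H * B) := by
    have hone : imageCone (1 : GL (Fin 2) ℝ) C ⊆ C := by
      rintro _ ⟨x, hx, rfl⟩
      simpa using hx
    have hHC : ∀ H ∈ Ah, imageCone H C ⊆ C := fun H hH => (hC.2 H hH).trans interior_subset
    intro g hg
    induction hg using Subsemigroup.closure_induction with
    | mem x hx =>
      rcases hx with hx | hx
      · exact ⟨(hCe x hx).subset, Or.inl (hM x hx)⟩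
      · refine ⟨hHC x hx, Or.inr ⟨1, x, 1, ⟨1, one_pos, fun v => ?_⟩, hone, hx, hone, by simp⟩⟩
        simp
    | mul x y _ _ hx hy =>
      refine ⟨imageCone_mul_subset hx.1 hy.1, ?_⟩
      rcases hx with ⟨hxC, hx | ⟨E, H, B, hE, hEC, hH, hB, rfl⟩⟩
      · rcases hy with ⟨hyC, hy | ⟨E, H, B, hE, hEC, hH, hB, rfl⟩⟩
        · exact Or.inl (hx.mul hy)
        · exact Or.inr ⟨x * E, H, B, hx.mul hE, imageCone_mul_subset hxC hEC, hH, hB,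
            by simp only [mul_assoc]⟩
      · exact Or.inr ⟨E, H, B * y, hE, hEC, hH, imageCone_mul_subset hB hy.1,
          by simp only [mul_assoc]⟩
  refine ⟨min k (c * k * c), lt_min hk (by positivity), fun g hg h hh => ?_⟩
  change _ * ‖(g : Matrix (Fin 2) (Fin 2) ℝ)‖ * ‖(h : Matrix (Fin 2) (Fin 2) ℝ)‖ ≤
    ‖((g * h : GL (Fin 2) ℝ) : Matrix (Fin 2) (Fin 2) ℝ)‖
  obtain ⟨hgC, -⟩ := hword g hg
  obtain ⟨hhC, hh | ⟨E, H, B, hE, hEC, hH, hB, hEHB⟩⟩ := hword h hh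
  · refine le_trans ?_ (hh.mul_norm_le_norm_mul_of_right hMdet)
    gcongr
    exact min_le_left _ _
  -- a vector on which both `h` and `g * h` are seen to expand well
  obtain ⟨x, hx⟩ := hC.1.1
  have hHx : H • x ∈ imageCone H C := ⟨x, hx, rfl⟩
  induction hx' : H • x using Projectivization.ind with
  | h v hv =>
    rw [hx'] at hHx
    have hv0 := nrm_pos hv
    have h1 := hexp h hhC H hH v hv hHx
    have hvC : mk ℝ v hv ∈ C := interior_subset (hC.2 H hH hHx)
    have hw : mk ℝ (((H * B : GL (Fin 2) ℝ) : Matrix (Fin 2) (Fin 2) ℝ) *ᵥ v)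
        (mulVec_ne_zero (GL_det_ne_zero _) hv) ∈ imageCone H C := by
      rw [← smul_mk_eq _ hv, mul_smul]
      exact ⟨_, hB ⟨_, hvC, rfl⟩, rfl⟩
    have h2 := hexp (g * E) (imageCone_mul_subset hgC hEC) H hH _ _ hw
    have h3 := hE.mul_norm_le_norm_mul_of_right (g := g) hMdet
    have h4 := nrm_mulVec_le (E : Matrix (Fin 2) (Fin 2) ℝ)
      (((H * B : GL (Fin 2) ℝ) : Matrix (Fin 2) (Fin 2) ℝ) *ᵥ v)
    have h5 := nrm_mulVec_le ((g * h : GL (Fin 2) ℝ) : Matrix (Fin 2) (Fin 2) ℝ) v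
    rw [Matrix.mulVec_mulVec, ← Units.val_mul, ← mul_assoc, ← hEHB] at h4
    rw [Matrix.mulVec_mulVec, ← Units.val_mul, show g * E * (H * B) = g * h by
      rw [hEHB]; simp only [mul_assoc]] at h2
    refine le_of_mul_le_mul_right ?_ hv0
    set w := nrm (((H * B : GL (Fin 2) ℝ) : Matrix (Fin 2) (Fin 2) ℝ) *ᵥ v)
    have hw0 : 0 ≤ w := nrm_nonneg _
    calc min k (c * k * c) * ‖(g : Matrix (Fin 2) (Fin 2) ℝ)‖ *
          ‖(h : Matrix (Fin 2) (Fin 2) ℝ)‖ * nrm v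
        ≤ (c * k * c) * ‖(g : Matrix (Fin 2) (Fin 2) ℝ)‖ *
          ‖(h : Matrix (Fin 2) (Fin 2) ℝ)‖ * nrm v := by
          gcongr
          exact min_le_right _ _
      _ = c * k * ‖(g : Matrix (Fin 2) (Fin 2) ℝ)‖ *
          (c * ‖(h : Matrix (Fin 2) (Fin 2) ℝ)‖ * nrm v) := by ring
      _ ≤ c * k * ‖(g : Matrix (Fin 2) (Fin 2) ℝ)‖ * (‖(E : Matrix (Fin 2) (Fin 2) ℝ)‖ * w) := by
          have := h1.trans h4
          gcongr
      _ = c * (k * ‖(g : Matrix (Fin 2) (Fin 2) ℝ)‖ * ‖(E : Matrix (Fin 2) (Fin 2) ℝ)‖) * w := by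
          ring
      _ ≤ c * ‖((g * E : GL (Fin 2) ℝ) : Matrix (Fin 2) (Fin 2) ℝ)‖ * w := by gcongr
      _ ≤ _ := h2.trans h5

/-! ### Neighbourhoods of sets of lines -/

/-- The closed neighbourhood of a set of lines of radius `ε` in the sine distance. The closure
makes it a union of balls of radius exactly `ε`. -/
def nearCone (K : Set RP1) (ε : ℝ) : Set RP1 := {x | ∃ y ∈ closure K, lineDist x y ≤ ε}

theorem subset_nearCone {K : Set RP1} {ε : ℝ} (hε : 0 ≤ ε) : K ⊆ nearCone K ε := fun x hx =>
  ⟨x, subset_closure hx, (lineDist_self x).trans_le hε⟩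

theorem exists_lineDist_lt_of_mem_nearCone {K : Set RP1} {ε η : ℝ} (hη : ε < η) {x : RP1}
    (hx : x ∈ nearCone K ε) : ∃ y ∈ K, lineDist x y < η := by
  obtain ⟨y, hy, hxy⟩ := hx
  have hmem : y ∈ {z | lineDist z x < η} := by
    rw [lineDist_comm] at hxy
    exact lt_of_le_of_lt hxy hη
  obtain ⟨z, hz, hzK⟩ := mem_closure_iff.mp hy _ (isOpen_lineDist_lt x η) hmem
  exact ⟨z, hzK, by rw [lineDist_comm]; exact hz⟩

theorem mem_interior_of_lineDist_lt {K C : Set RP1} {η : ℝ}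
    (hC : ∀ x, ∀ y ∈ K, lineDist x y < η → x ∈ C) {x y : RP1} (hy : y ∈ K)
    (hxy : lineDist x y < η) : x ∈ interior C :=
  mem_interior.mpr ⟨{z | lineDist z y < η}, fun z hz => hC z y hy hz, isOpen_lineDist_lt y η, hxy⟩

theorem abs_sin_le_iff {x δ : ℝ} (hx : |x| ≤ Real.pi / 2) (h0 : 0 ≤ δ) (hδ : δ ≤ Real.pi / 2) :
    |Real.sin x| ≤ Real.sin δ ↔ |x| ≤ δ := by
  have hpi := Real.pi_pos
  have h1 : |Real.sin x| = Real.sin |x| :=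
    Real.abs_sin_eq_sin_abs_of_abs_le_pi (by linarith)
  rw [h1, Real.strictMonoOn_sin.le_iff_le ⟨by linarith [abs_nonneg x], hx⟩ ⟨by linarith, hδ⟩]

theorem dir_mem_nearCone_iff {K : Set RP1} {δ : ℝ} (h0 : 0 ≤ δ) (hδ : δ ≤ Real.pi / 2) {θ : ℝ} :
    dir θ ∈ nearCone K (Real.sin δ) ↔ ∃ t, dir t ∈ closure K ∧ |θ - t| ≤ δ := by
  constructor
  · rintro ⟨y, hy, hxy⟩
    obtain ⟨t, ht, rfl⟩ := exists_mem_Ico_dir_eq (θ - Real.pi / 2) y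
    refine ⟨t, hy, ?_⟩
    rw [lineDist_dir] at hxy
    exact (abs_sin_le_iff (abs_le.mpr ⟨by linarith [ht.2], by linarith [ht.1]⟩) h0 hδ).mp hxy
  · rintro ⟨t, ht, h⟩
    refine ⟨dir t, ht, ?_⟩
    rw [lineDist_dir]
    exact (abs_sin_le_iff (h.trans hδ) h0 hδ).mpr h

/-- A closed neighbourhood of small radius is a finite union of closed intervals: cut a period
into arcs `J` shorter than the radius `δ`. The `δ`-neighbourhood of the part of the set lying in
`J` is the single interval `[min - δ, max + δ]`. -/
theorem exists_finite_intervals_nearCone (K : Set RP1) {ε : ℝ} (hε : 0 < ε) (hε' : ε ≤ 1 / 2) :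
    ∃ F : Set (Set RP1), F.Finite ∧ (∀ I ∈ F, IsClosedInterval I) ∧ nearCone K ε = ⋃₀ F := by
  obtain ⟨δ, hδ0, hδ, rfl⟩ : ∃ δ, 0 < δ ∧ δ ≤ Real.pi / 6 ∧ Real.sin δ = ε := by
    refine ⟨Real.arcsin ε, Real.arcsin_pos.mpr hε, ?_, Real.sin_arcsin (by linarith) (by linarith)⟩
    have hpi := Real.pi_pos
    rw [Real.arcsin_le_iff_le_sin' ⟨by linarith, by linarith⟩, Real.sin_pi_div_six]
    exact hε'
  have hpi := Real.pi_pos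
  set T : ℕ → Set ℝ := fun i => Icc (i * δ) ((i + 1) * δ) ∩ dir ⁻¹' closure K with hT
  have hTc : ∀ i, IsCompact (T i) := fun i =>
    isCompact_Icc.inter_right (isClosed_closure.preimage continuous_dir)
  obtain ⟨n, hn⟩ := exists_nat_gt (Real.pi / δ)
  set I : ℕ → Set RP1 := fun i => dir '' Icc (sInf (T i) - δ) (sSup (T i) + δ) with hI
  refine ⟨I '' {i | i < n ∧ (T i).Nonempty}, ((finite_lt_nat n).subset fun i hi => hi.1).image _,
    ?_, ?_⟩
  · rintro _ ⟨i, ⟨-, hne⟩, rfl⟩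
    have h1 := (hTc i).sInf_mem hne
    have h2 := (hTc i).sSup_mem hne
    have h3 : sInf (T i) ≤ sSup (T i) := (hTc i).isLeast_sInf hne |>.2 h2
    have h4 := h1.1.1
    have h5 := h2.1.2
    exact ⟨_, _, by linarith, by linarith, rfl⟩
  · ext x
    constructor
    · intro hx
      obtain ⟨θ₀, rfl⟩ := dir_surjective x
      obtain ⟨t₀, ht₀, hθt⟩ := (dir_mem_nearCone_iff hδ0.le (by linarith)).mp hx
      obtain ⟨θ, t, hθ, ht, ⟨h0, h1⟩, hd⟩ : ∃ θ t, dir θ = dir θ₀ ∧ dir t ∈ closure K ∧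
          t ∈ Ico 0 Real.pi ∧ |θ - t| ≤ δ := by
        have hp : Function.Periodic dir Real.pi := dir_add_pi
        have hmod := toIcoMod_mem_Ico Real.pi_pos 0 t₀
        rw [zero_add, toIcoMod] at hmod
        refine ⟨θ₀ - toIcoDiv Real.pi_pos 0 t₀ • Real.pi, t₀ - toIcoDiv Real.pi_pos 0 t₀ • Real.pi,
          hp.sub_zsmul_eq _, ?_, hmod, ?_⟩
        · rwa [hp.sub_zsmul_eq]
        · rwa [sub_sub_sub_cancel_right]
      -- the index of the arc that contains `t`
      have hdiv : 0 ≤ t / δ := by positivity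
      have hle := (le_div_iff₀ hδ0).mp (Nat.floor_le hdiv)
      have hlt := (div_lt_iff₀ hδ0).mp (Nat.lt_floor_add_one (t / δ))
      have htT : t ∈ T ⌊t / δ⌋₊ := ⟨⟨hle, hlt.le⟩, ht⟩
      have hin : ⌊t / δ⌋₊ < n := by
        refine (Nat.floor_lt hdiv).mpr (lt_trans ?_ hn)
        gcongr
      refine ⟨I ⌊t / δ⌋₊, ⟨_, ⟨hin, t, htT⟩, rfl⟩, θ, ?_, hθ⟩
      have h3 : sInf (T ⌊t / δ⌋₊) ≤ t := ((hTc _).isLeast_sInf ⟨t, htT⟩).2 htT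
      have h4 : t ≤ sSup (T ⌊t / δ⌋₊) := ((hTc _).isGreatest_sSup ⟨t, htT⟩).2 htT
      have := abs_le.mp hd
      exact ⟨by linarith, by linarith⟩
    · rintro ⟨_, ⟨i, ⟨-, hne⟩, rfl⟩, θ, ⟨h1, h2⟩, rfl⟩
      rw [dir_mem_nearCone_iff hδ0.le (by linarith)]
      have ha := (hTc i).sInf_mem hne
      have hb := (hTc i).sSup_mem hne
      have ha' := ha.1.1
      have hb' := hb.1.2
      rcases le_total θ (sInf (T i) + δ) with h | h
      · exact ⟨_, ha.2, abs_le.mpr ⟨by linarith, by linarith⟩⟩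
      · exact ⟨_, hb.2, abs_le.mpr ⟨by linarith, by linarith⟩⟩

/-! ### Almost multiplicative monoids -/

/-- The situation reached from an almost multiplicative semigroup by normalization: a closed
monoid of matrices of determinant `±1` on which the norm is almost multiplicative, with a finite
set `S` of members whose inverses lie outside the monoid. -/
structure IsAlmostMulMonoid (Γ : Submonoid (Matrix (Fin 2) (Fin 2) ℝ)) (κ : ℝ)
    (S : Set (Matrix (Fin 2) (Fin 2) ℝ)) : Prop where
  isClosed : IsClosed (Γ : Set (Matrix (Fin 2) (Fin 2) ℝ))
  abs_det : ∀ g ∈ Γ, |g.det| = 1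
  pos : 0 < κ
  le_one : κ ≤ 1
  mul_le : ∀ g ∈ Γ, ∀ h ∈ Γ, κ * ‖g‖ * ‖h‖ ≤ ‖g * h‖
  finite : S.Finite
  subset : ∀ H ∈ S, H ∈ Γ
  inv_notMem : ∀ H ∈ S, H⁻¹ ∉ Γ

variable {Γ : Submonoid (Matrix (Fin 2) (Fin 2) ℝ)} {κ : ℝ} {S : Set (Matrix (Fin 2) (Fin 2) ℝ)}

theorem IsAlmostMulMonoid.det_ne_zero (h : IsAlmostMulMonoid Γ κ S)
    {g : Matrix (Fin 2) (Fin 2) ℝ} (hg : g ∈ Γ) : g.det ≠ 0 := by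
  intro h0
  have := h.abs_det g hg
  simp [h0] at this

theorem IsAlmostMulMonoid.one_le_norm (h : IsAlmostMulMonoid Γ κ S)
    {g : Matrix (Fin 2) (Fin 2) ℝ} (hg : g ∈ Γ) : 1 ≤ ‖g‖ :=
  PlanarCocycle.one_le_norm (h.abs_det g hg)

theorem IsAlmostMulMonoid.norm_inv_le (h : IsAlmostMulMonoid Γ κ S)
    {g : Matrix (Fin 2) (Fin 2) ℝ} (hg : g ∈ Γ) : ‖g⁻¹‖ ≤ ‖g‖ := by
  have := abs_det_mul_norm_inv (h.det_ne_zero hg)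
  rwa [h.abs_det g hg, one_mul] at this

theorem isCompact_norm_le (R : ℝ) : IsCompact {g : Matrix (Fin 2) (Fin 2) ℝ | ‖g‖ ≤ R} := by
  have := isCompact_closedBall (0 : Matrix (Fin 2) (Fin 2) ℝ) R
  simpa [Metric.closedBall, dist_eq_norm] using this

/-- Products with a factor in `S` stay away from the identity: otherwise, by compactness,
`a * H * b = 1` for some `a, b ∈ Γ`, and then `H⁻¹ = b * a ∈ Γ`. -/
theorem IsAlmostMulMonoid.exists_le_norm_sub_one (h : IsAlmostMulMonoid Γ κ S) :
    ∃ η > 0, ∀ H ∈ S, ∀ a ∈ Γ, ∀ b ∈ Γ, η ≤ ‖a * H * b - 1‖ := by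
  suffices hsuff : ∀ H ∈ S, ∃ η > 0, ∀ a ∈ Γ, ∀ b ∈ Γ, η ≤ ‖a * H * b - 1‖ from
    exists_pos_forall_of_finite h.finite
      (fun H δ δ' hδ' hP a ha b hb => hδ'.trans (hP a ha b hb)) hsuff
  intro H hH
  have hκ := h.pos
  set X : Set (Matrix (Fin 2) (Fin 2) ℝ) :=
    {g | ‖g‖ ≤ 2 / κ ^ 2} ∩ (Γ : Set (Matrix (Fin 2) (Fin 2) ℝ)) with hX
  have hXc : IsCompact X := (isCompact_norm_le _).inter_right h.isClosed
  have hXne : (X ×ˢ X).Nonempty := by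
    have : (1 : Matrix (Fin 2) (Fin 2) ℝ) ∈ X := by
      refine ⟨?_, Γ.one_mem⟩
      change ‖(1 : Matrix (Fin 2) (Fin 2) ℝ)‖ ≤ _
      rw [norm_one_mat, le_div_iff₀ (by positivity)]
      nlinarith [h.le_one]
    exact ⟨(1, 1), this, this⟩
  have hcont : ContinuousOn (fun p : Matrix (Fin 2) (Fin 2) ℝ × Matrix (Fin 2) (Fin 2) ℝ =>
      ‖p.1 * H * p.2 - 1‖) (X ×ˢ X) := by
    fun_prop
  obtain ⟨⟨a₀, b₀⟩, hab₀, hmin⟩ := (hXc.prod hXc).exists_isMinOn hXne hcont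
  have hpos : 0 < ‖a₀ * H * b₀ - 1‖ := by
    rw [norm_pos_iff, sub_ne_zero]
    intro h1
    refine h.inv_notMem H hH ?_
    have h2 : H * b₀ * a₀ = 1 := by
      rw [mul_eq_one_comm, ← mul_assoc]
      exact h1
    rw [Matrix.inv_eq_right_inv (show H * (b₀ * a₀) = 1 by rw [← mul_assoc]; exact h2)]
    exact Γ.mul_mem hab₀.2.2 hab₀.1.2
  refine ⟨min 1 ‖a₀ * H * b₀ - 1‖, lt_min one_pos hpos, fun a ha b hb => ?_⟩
  by_contra! hcon
  have hlt1 := lt_of_lt_of_le hcon (min_le_left _ _)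
  have hn : ‖a * H * b‖ ≤ 2 := by
    have := norm_le_norm_add_norm_sub' (a * H * b) 1
    rw [norm_one_mat] at this
    linarith
  have hm1 := h.mul_le _ (Γ.mul_mem ha (h.subset H hH)) b hb
  have hm2 := h.mul_le a ha H (h.subset H hH)
  have h1a := h.one_le_norm ha
  have h1b := h.one_le_norm hb
  have h1H := h.one_le_norm (h.subset H hH)
  have hprod : κ ^ 2 * (‖a‖ * ‖b‖) ≤ 2 := by
    calc κ ^ 2 * (‖a‖ * ‖b‖) = κ * (κ * ‖a‖ * 1) * ‖b‖ := by ring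
      _ ≤ κ * (κ * ‖a‖ * ‖H‖) * ‖b‖ := by gcongr
      _ ≤ κ * ‖a * H‖ * ‖b‖ := by gcongr
      _ ≤ 2 := hm1.trans hn
  have haX : a ∈ X := by
    refine ⟨?_, ha⟩
    change ‖a‖ ≤ _
    rw [le_div_iff₀' (by positivity)]
    refine le_trans ?_ hprod
    gcongr
    exact le_mul_of_one_le_right (norm_nonneg _) h1b
  have hbX : b ∈ X := by
    refine ⟨?_, hb⟩
    change ‖b‖ ≤ _
    rw [le_div_iff₀' (by positivity)]
    refine le_trans ?_ hprod
    gcongr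
    exact le_mul_of_one_le_left (norm_nonneg _) h1a
  have hle : ‖a₀ * H * b₀ - 1‖ ≤ ‖a * H * b - 1‖ :=
    isMinOn_iff.mp hmin (a, b) (mk_mem_prod haX hbX)
  exact absurd (lt_of_lt_of_le hcon (min_le_right _ _)) (not_lt.mpr hle)

/-- The products of `n` factors `E * H` with `H ∈ S` and `E` invertible in the monoid `Γ`. -/
def words (Γ : Submonoid (Matrix (Fin 2) (Fin 2) ℝ)) (S : Set (Matrix (Fin 2) (Fin 2) ℝ)) :
    ℕ → Set (Matrix (Fin 2) (Fin 2) ℝ)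
  | 0 => {1}
  | n + 1 => {m | ∃ E ∈ Γ, E⁻¹ ∈ Γ ∧ ∃ H ∈ S, ∃ p ∈ words Γ S n, m = E * H * p}

theorem IsAlmostMulMonoid.words_subset (h : IsAlmostMulMonoid Γ κ S) {n : ℕ} :
    ∀ p ∈ words Γ S n, p ∈ Γ := by
  induction n with
  | zero =>
    rintro p rfl
    exact Γ.one_mem
  | succ n ih =>
    rintro _ ⟨E, hE, -, H, hH, p, hp, rfl⟩
    exact Γ.mul_mem (Γ.mul_mem hE (h.subset H hH)) (ih p hp)

theorem words_nonempty (hS : S.Nonempty) (n : ℕ) : (words Γ S n).Nonempty := by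
  induction n with
  | zero => exact ⟨1, rfl⟩
  | succ n ih =>
    obtain ⟨p, hp⟩ := ih
    obtain ⟨H, hH⟩ := hS
    exact ⟨_, 1, Γ.one_mem, by rw [inv_one]; exact Γ.one_mem, H, hH, p, hp, rfl⟩

/-- The suffixes of a word: each is obtained from any shorter one by a left factor that contains
a letter of `S`. -/
theorem IsAlmostMulMonoid.exists_suffixes (h : IsAlmostMulMonoid Γ κ S) {n : ℕ} :
    ∀ p ∈ words Γ S n, ∃ q : ℕ → Matrix (Fin 2) (Fin 2) ℝ, q n = p ∧ (∀ i ≤ n, q i ∈ Γ) ∧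
      ∀ j ≤ n, ∀ i < j, ∃ a ∈ Γ, ∃ H ∈ S, ∃ b ∈ Γ, q j = a * H * b * q i := by
  induction n with
  | zero =>
    rintro p rfl
    refine ⟨fun _ => 1, rfl, fun _ _ => Γ.one_mem, fun j hj i hi => ?_⟩
    omega
  | succ n ih =>
    rintro _ ⟨E, hE, hE', H, hH, p, hp, rfl⟩
    obtain ⟨q, hqn, hqΓ, hq⟩ := ih p hp
    have hw : E * H * p ∈ Γ :=
      Γ.mul_mem (Γ.mul_mem hE (h.subset H hH)) (h.words_subset p hp)
    refine ⟨fun i => if i ≤ n then q i else E * H * p, by simp, fun i _ => ?_, fun j hj i hij => ?_⟩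
    · dsimp only
      split_ifs with hi
      · exact hqΓ i hi
      · exact hw
    · have hin : i ≤ n := by omega
      dsimp only
      rw [if_pos hin]
      split_ifs with hjn
      · exact hq j hjn i hij
      · rcases hin.eq_or_lt with rfl | hlt
        · exact ⟨E, hE, H, hH, 1, Γ.one_mem, by rw [hqn, mul_one]⟩
        · obtain ⟨a, ha, H', hH', b, hb, hqn'⟩ := hq n le_rfl i hlt
          refine ⟨E * H * a, Γ.mul_mem (Γ.mul_mem hE (h.subset H hH)) ha, H', hH', b, hb, ?_⟩
          rw [← hqn, hqn']
          simp only [mul_assoc]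

/-- Long words have large norm. If a long word is bounded then so are all its suffixes, two of
them are close to each other, and their quotient is close to the identity. -/
theorem IsAlmostMulMonoid.exists_lt_norm (h : IsAlmostMulMonoid Γ κ S) (R : ℝ) :
    ∃ n, ∀ p ∈ words Γ S (n + 1), R < ‖p‖ := by
  obtain ⟨η, hη, hsep⟩ := h.exists_le_norm_sub_one
  have hκ := h.pos
  wlog hR : 1 ≤ R generalizing R
  · obtain ⟨n, hn⟩ := this 1 le_rfl
    exact ⟨n, fun p hp => (not_le.mp hR).trans (hn p hp)⟩
  have hρ : 0 < η * κ / (4 * R) := by positivity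
  obtain ⟨t, -, htf, htc⟩ := (isCompact_norm_le (R / κ)).finite_cover_balls hρ
  lift t to Finset (Matrix (Fin 2) (Fin 2) ℝ) using htf
  refine ⟨t.card, fun p hp => ?_⟩
  by_contra! hpR
  obtain ⟨q, hqn, hqΓ, hq⟩ := h.exists_suffixes p hp
  have hqle : ∀ i ≤ t.card, ‖q i‖ ≤ R / κ := by
    intro i hi
    obtain ⟨a, ha, H, hH, b, hb, e⟩ := hq (t.card + 1) le_rfl i (by omega)
    have hr : a * H * b ∈ Γ := Γ.mul_mem (Γ.mul_mem ha (h.subset H hH)) hb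
    have h1 := h.mul_le _ hr (q i) (hqΓ i (by omega))
    rw [← e, hqn] at h1
    have h2 := h.one_le_norm hr
    rw [le_div_iff₀' hκ]
    refine le_trans ?_ (h1.trans hpR)
    rw [mul_right_comm]
    exact le_mul_of_one_le_right (by positivity) h2
  have hcover : ∀ i ≤ t.card, ∃ x ∈ t, dist (q i) x < η * κ / (4 * R) := by
    intro i hi
    have := htc (hqle i hi)
    simpa using this
  choose! f hft hfd using hcover
  obtain ⟨i, hi, j, hj, hij, hfij⟩ := Finset.exists_ne_map_eq_of_card_lt_of_maps_to
    (s := Finset.range (t.card + 1)) (t := t) (f := f) (by simp)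
    (fun i hi => hft i (Nat.lt_succ_iff.mp (Finset.mem_range.mp hi)))
  wlog hlt : i < j generalizing i j
  · exact this j hj i hi hij.symm hfij.symm (by omega)
  have hi' : i ≤ t.card := Nat.lt_succ_iff.mp (Finset.mem_range.mp hi)
  have hj' : j ≤ t.card := Nat.lt_succ_iff.mp (Finset.mem_range.mp hj)
  obtain ⟨a, ha, H, hH, b, hb, e⟩ := hq j (by omega) i hlt
  have hqi := hqΓ i (by omega)
  have hd : ‖q j - q i‖ ≤ η * κ / (2 * R) := by
    have h1 := hfd i hi'
    have h2 := hfd j hj'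
    rw [hfij, dist_comm] at h1
    have h3 := dist_triangle (q j) (f j) (q i)
    rw [dist_eq_norm (q j) (q i)] at h3
    have h4 : η * κ / (2 * R) = η * κ / (4 * R) + η * κ / (4 * R) := by
      field_simp
      norm_num
    linarith
  have h5 : a * H * b - 1 = (q j - q i) * (q i)⁻¹ := by
    rw [sub_mul, e, mul_assoc _ (q i), Matrix.mul_nonsing_inv _
      (isUnit_iff_ne_zero.mpr (h.det_ne_zero hqi)), mul_one]
  have h6 := hsep H hH a ha b hb
  rw [h5] at h6
  have h7 : ‖(q j - q i) * (q i)⁻¹‖ ≤ η * κ / (2 * R) * (R / κ) :=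
    (norm_mul_le _ _).trans (mul_le_mul hd ((h.norm_inv_le hqi).trans (hqle i hi'))
      (norm_nonneg _) (by positivity))
  have h8 : η * κ / (2 * R) * (R / κ) = η / 2 := by
    field_simp
  linarith

/-- Vectors that every matrix of `Γ` expands by at least the fraction `c` of its norm. -/
def IsExpanded (Γ : Submonoid (Matrix (Fin 2) (Fin 2) ℝ)) (c : ℝ) (v : Fin 2 → ℝ) : Prop :=
  ∀ g ∈ Γ, c * ‖g‖ * nrm v ≤ nrm (g *ᵥ v)

theorem IsExpanded.smul {c : ℝ} {v : Fin 2 → ℝ} (hv : IsExpanded Γ c v) (r : ℝ) :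
    IsExpanded Γ c (r • v) := by
  intro g hg
  rw [Matrix.mulVec_smul, nrm_smul, nrm_smul]
  have := mul_le_mul_of_nonneg_left (hv g hg) (abs_nonneg r)
  linarith

theorem IsExpanded.mono {c c' : ℝ} (hc : c' ≤ c) {v : Fin 2 → ℝ} (hv : IsExpanded Γ c v) :
    IsExpanded Γ c' v := fun g hg => by
  refine le_trans ?_ (hv g hg)
  have := nrm_nonneg v
  gcongr

/-- Expansion survives under the monoid, with a loss of the factor `κ`. -/
theorem IsAlmostMulMonoid.isExpanded_mulVec (h : IsAlmostMulMonoid Γ κ S) {c : ℝ} (hc : 0 ≤ c)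
    {v : Fin 2 → ℝ} (hv : IsExpanded Γ c v) {p : Matrix (Fin 2) (Fin 2) ℝ} (hp : p ∈ Γ) :
    IsExpanded Γ (c * κ) (p *ᵥ v) := by
  intro g hg
  have h1 := hv (g * p) (Γ.mul_mem hg hp)
  have h2 := h.mul_le g hg p hp
  have h3 := nrm_mulVec_le p v
  have h4 := h.pos
  have h5 := nrm_nonneg v
  rw [Matrix.mulVec_mulVec]
  calc c * κ * ‖g‖ * nrm (p *ᵥ v) ≤ c * κ * ‖g‖ * (‖p‖ * nrm v) := by gcongr
    _ = c * (κ * ‖g‖ * ‖p‖) * nrm v := by ring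
    _ ≤ c * ‖g * p‖ * nrm v := by gcongr
    _ ≤ _ := h1

/-- A matrix of large norm sends the vectors that it expands well to vectors expanded almost by
the factor `κ`: the images of all unit vectors under `p` lie close to a single line, along which
almost multiplicativity forces every `g ∈ Γ` to expand. -/
theorem IsAlmostMulMonoid.isExpanded_of_large (h : IsAlmostMulMonoid Γ κ S) {c : ℝ} (hc : 0 < c)
    {p : Matrix (Fin 2) (Fin 2) ℝ} (hp : p ∈ Γ) (hlarge : 2 ≤ κ * (c * ‖p‖ ^ 2))
    {v : Fin 2 → ℝ} (hv0 : v ≠ 0) (hv : c * ‖p‖ * nrm v ≤ nrm (p *ᵥ v)) :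
    IsExpanded Γ (κ / 2) (p *ᵥ v) := by
  intro g hg
  have hn := nrm_pos (mulVec_ne_zero (h.det_ne_zero hp) hv0)
  set n := nrm (p *ᵥ v) with hn_def
  set X := nrm (g *ᵥ (p *ᵥ v)) with hX
  have hX0 : 0 ≤ X := nrm_nonneg _
  have hv1 := nrm_nonneg v
  have hp1 := h.one_le_norm hp
  have hκ := h.pos
  have h1 : n ^ 2 * ‖g * p‖ ≤ n * ‖p‖ * X + nrm v * (‖g‖ * n) := by
    refine mul_norm_le_of_forall_nrm (by positivity) (by positivity) fun w => ?_
    rw [← Matrix.mulVec_mulVec]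
    refine (nrm_sq_mul_nrm_mulVec_le g (p *ᵥ v) (p *ᵥ w)).trans ?_
    have h2 : |(p *ᵥ v) ⬝ᵥ (p *ᵥ w)| ≤ n * (‖p‖ * nrm w) :=
      (abs_dotProduct_le _ _).trans (mul_le_mul_of_nonneg_left (nrm_mulVec_le p w) hn.le)
    have h3 : |wedge (p *ᵥ v) (p *ᵥ w)| ≤ nrm v * nrm w := by
      rw [wedge_mulVec, abs_mul, h.abs_det p hp, one_mul]
      exact abs_wedge_le v w
    calc _ ≤ n * (‖p‖ * nrm w) * X + nrm v * nrm w * (‖g‖ * n) := by gcongr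
      _ = _ := by ring
  have h2 := h.mul_le g hg p hp
  have h3 : n * (κ * ‖g‖ * ‖p‖) ≤ ‖p‖ * X + nrm v * ‖g‖ := by
    have h4 : n * (n * (κ * ‖g‖ * ‖p‖)) ≤ n * (‖p‖ * X + nrm v * ‖g‖) := by
      calc n * (n * (κ * ‖g‖ * ‖p‖)) ≤ n * (n * ‖g * p‖) := by gcongr
        _ = n ^ 2 * ‖g * p‖ := by ring
        _ ≤ n * ‖p‖ * X + nrm v * (‖g‖ * n) := h1
        _ = _ := by ring
    exact le_of_mul_le_mul_left h4 hn
  have h5 : 0 < c * ‖p‖ ^ 2 := by positivity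
  refine le_of_mul_le_mul_left ?_ h5
  have h6 : c * ‖p‖ * (n * (κ * ‖g‖ * ‖p‖)) ≤ c * ‖p‖ * (‖p‖ * X + nrm v * ‖g‖) := by gcongr
  have h7 : c * ‖p‖ * nrm v * ‖g‖ ≤ n * ‖g‖ := by gcongr
  have h8 : 2 * (n * ‖g‖) ≤ κ * (c * ‖p‖ ^ 2) * (n * ‖g‖) := by gcongr
  nlinarith [h6, h7, h8]

/-- Expansion is stable under small perturbations of the direction. -/
theorem IsExpanded.of_sinDist_lt {c : ℝ} (hc1 : c ≤ 1) {v w : Fin 2 → ℝ}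
    (hv : IsExpanded Γ c v) (hv0 : v ≠ 0) (hw0 : w ≠ 0) (hvw : sinDist v w < c / 4) :
    IsExpanded Γ (c / 2) w := by
  intro g hg
  have hn := nrm_pos hv0
  have hm := nrm_pos hw0
  have hs0 := sinDist_nonneg v w
  set s := sinDist v w with hs
  have hwedge := abs_wedge_eq hv0 hw0
  rw [← hs] at hwedge
  have hdot : (1 - s) * (nrm v * nrm w) ≤ |v ⬝ᵥ w| := by
    refine abs_le_of_sq_le_sq' ?_ (abs_nonneg _) |>.2
    rw [sq_abs]
    have h1 := dotProduct_sq_add_wedge_sq v w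
    have h2 : wedge v w ^ 2 = (s * (nrm v * nrm w)) ^ 2 := by rw [← hwedge, sq_abs]
    have h3 : 0 ≤ (2 * s - 2 * s ^ 2) * (nrm v * nrm w) ^ 2 :=
      mul_nonneg (by nlinarith) (sq_nonneg _)
    nlinarith
  have hperp : nrm (g *ᵥ perp v) ≤ ‖g‖ * nrm v := by
    have := nrm_mulVec_le g (perp v)
    rwa [nrm_perp] at this
  have e : (v ⬝ᵥ w) • (g *ᵥ v) = nrm v ^ 2 • (g *ᵥ w) + (-wedge v w) • (g *ᵥ perp v) := by
    have h1 := congrArg (fun u => g *ᵥ u) (nrm_sq_smul_eq v w)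
    simp only [Matrix.mulVec_add, Matrix.mulVec_smul] at h1
    rw [h1, neg_smul, add_neg_cancel_right]
  have h4 : |v ⬝ᵥ w| * nrm (g *ᵥ v) ≤
      nrm v ^ 2 * nrm (g *ᵥ w) + s * (nrm v * nrm w) * (‖g‖ * nrm v) := by
    rw [← nrm_smul, e]
    refine (nrm_add_le _ _).trans ?_
    rw [nrm_smul, nrm_smul, abs_neg, hwedge, abs_of_nonneg (sq_nonneg _)]
    gcongr
  have h5 : (1 - s) * (nrm v * nrm w) * (c * ‖g‖ * nrm v) ≤ |v ⬝ᵥ w| * nrm (g *ᵥ v) := by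
    have hc0 : 0 ≤ c := by linarith
    exact mul_le_mul hdot (hv g hg) (by positivity) (abs_nonneg _)
  have h6 : ((1 - s) * c - s) * (‖g‖ * nrm w) ≤ nrm (g *ᵥ w) := by
    refine le_of_mul_le_mul_left ?_ (pow_pos hn 2)
    nlinarith
  refine le_trans ?_ h6
  rw [mul_assoc]
  refine mul_le_mul_of_nonneg_right ?_ (by positivity)
  nlinarith

/-! ### Construction of the multicone -/

theorem isExpanded_rep_mk_iff {c : ℝ} {v : Fin 2 → ℝ} (hv : v ≠ 0) :
    IsExpanded Γ c (mk ℝ v hv).rep ↔ IsExpanded Γ c v := by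
  obtain ⟨a, ha⟩ := exists_smul_eq_mk_rep ℝ v hv
  rw [← ha, Units.smul_def]
  refine ⟨fun h => ?_, fun h => h.smul _⟩
  have := h.smul ((a : ℝ)⁻¹)
  rwa [smul_smul, inv_mul_cancel₀ a.ne_zero, one_smul] at this

theorem isExpanded_rep_of_lineDist_lt {c : ℝ} (hc1 : c ≤ 1) {x y : RP1}
    (hy : IsExpanded Γ c y.rep) (hxy : lineDist x y < c / 4) : IsExpanded Γ (c / 2) x.rep := by
  refine hy.of_sinDist_lt hc1 y.rep_nonzero x.rep_nonzero ?_
  rwa [sinDist_comm]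

theorem lineDist_smul_le (g : GL (Fin 2) ℝ) (x y : RP1) :
    lineDist (g • x) (g • y) ≤ |(g : Matrix (Fin 2) (Fin 2) ℝ).det| *
      ‖(g : Matrix (Fin 2) (Fin 2) ℝ)⁻¹‖ ^ 2 * lineDist x y := by
  induction x using Projectivization.ind with
  | h v hv =>
    induction y using Projectivization.ind with
    | h w hw =>
      rw [smul_mk_eq, smul_mk_eq, lineDist_mk, lineDist_mk]
      exact sinDist_mulVec_le (GL_det_ne_zero g) hv hw

/-- The images under the words of length `k` of the lines that `Γ` expands by the factor `c`. -/
def orbitCone (Γ : Submonoid (Matrix (Fin 2) (Fin 2) ℝ)) (S : Set (Matrix (Fin 2) (Fin 2) ℝ))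
    (c : ℝ) (k : ℕ) : Set RP1 :=
  {x | ∃ p ∈ words Γ S k, ∃ v, v ≠ 0 ∧ IsExpanded Γ c v ∧ ∃ h : p *ᵥ v ≠ 0, x = mk ℝ (p *ᵥ v) h}

theorem mem_orbitCone_zero {c : ℝ} {x : RP1} (hx : IsExpanded Γ c x.rep) :
    x ∈ orbitCone Γ S c 0 := by
  refine ⟨1, rfl, x.rep, x.rep_nonzero, hx, by simpa using x.rep_nonzero, ?_⟩
  exact (mk_rep x).symm.trans (mk_congr (Matrix.one_mulVec _).symm _ _)

theorem smul_mem_orbitCone_succ {c : ℝ} {k : ℕ} {H : GL (Fin 2) ℝ}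
    (hH : (H : Matrix (Fin 2) (Fin 2) ℝ) ∈ S) {x : RP1} (hx : x ∈ orbitCone Γ S c k) :
    H • x ∈ orbitCone Γ S c (k + 1) := by
  obtain ⟨p, hp, v, hv, hvc, hpv, rfl⟩ := hx
  have e : (1 * (H : Matrix (Fin 2) (Fin 2) ℝ) * p) *ᵥ v =
      (H : Matrix (Fin 2) (Fin 2) ℝ) *ᵥ (p *ᵥ v) := by
    rw [one_mul, Matrix.mulVec_mulVec]
  refine ⟨_, ⟨1, Γ.one_mem, by rw [inv_one]; exact Γ.one_mem, H, hH, p, hp, rfl⟩, v, hv, hvc, ?_,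
    ?_⟩
  · rw [e]
    exact mulVec_ne_zero (GL_det_ne_zero H) hpv
  · exact (smul_mk_eq H hpv).trans (mk_congr e.symm _ _)

/-- The orbit cones are invariant under the invertible elements of `Γ`. -/
theorem smul_mem_orbitCone
    (horth : ∀ g ∈ Γ, g⁻¹ ∈ Γ → ∀ v, nrm (g *ᵥ v) = nrm v) {c : ℝ} (hc : 0 ≤ c)
    {E : GL (Fin 2) ℝ} (hE : (E : Matrix (Fin 2) (Fin 2) ℝ) ∈ Γ)
    (hE' : (E : Matrix (Fin 2) (Fin 2) ℝ)⁻¹ ∈ Γ) {k : ℕ} {x : RP1}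
    (hx : x ∈ orbitCone Γ S c k) : E • x ∈ orbitCone Γ S c k := by
  obtain ⟨p, hp, v, hv, hvc, hpv, rfl⟩ := hx
  rw [smul_mk_eq]
  cases k with
  | zero =>
    obtain rfl : p = 1 := hp
    refine mem_orbitCone_zero ((isExpanded_rep_mk_iff _).mpr ?_)
    intro g hg
    rw [Matrix.one_mulVec, horth _ hE hE', Matrix.mulVec_mulVec]
    refine le_trans ?_ (hvc _ (Γ.mul_mem hg hE))
    have h1 : ‖g‖ ≤ ‖g * (E : Matrix (Fin 2) (Fin 2) ℝ)‖ := by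
      refine norm_le_of_nrm_mulVec_le (norm_nonneg _) fun u => ?_
      have h2 := nrm_mulVec_le (g * (E : Matrix (Fin 2) (Fin 2) ℝ))
        ((E : Matrix (Fin 2) (Fin 2) ℝ)⁻¹ *ᵥ u)
      rw [← Matrix.mulVec_mulVec, mulVec_inv_mulVec (GL_det_ne_zero E)] at h2
      rwa [horth _ hE' (by
        rw [Matrix.nonsing_inv_nonsing_inv _ (isUnit_iff_ne_zero.mpr (GL_det_ne_zero E))]
        exact hE)] at h2
    have := nrm_nonneg v
    gcongr
  | succ n =>
    obtain ⟨E₁, hE₁, hE₁', H, hH, q, hq, rfl⟩ := hp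
    have e : ((E : Matrix (Fin 2) (Fin 2) ℝ) * E₁ * H * q) *ᵥ v =
        (E : Matrix (Fin 2) (Fin 2) ℝ) *ᵥ ((E₁ * H * q) *ᵥ v) := by
      rw [Matrix.mulVec_mulVec]
      simp only [mul_assoc]
    refine ⟨_, ⟨E * E₁, Γ.mul_mem hE hE₁, ?_, H, hH, q, hq, rfl⟩, v, hv, hvc, ?_, ?_⟩
    · rw [Matrix.mul_inv_rev]
      exact Γ.mul_mem hE₁' hE'
    · rw [e]
      exact mulVec_ne_zero (GL_det_ne_zero E) hpv
    · exact mk_congr e.symm _ _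

theorem IsAlmostMulMonoid.isExpanded_of_mem_orbitCone (h : IsAlmostMulMonoid Γ κ S) {c : ℝ}
    (hc : 0 ≤ c) {k : ℕ} {x : RP1} (hx : x ∈ orbitCone Γ S c k) :
    IsExpanded Γ (c * κ) x.rep := by
  obtain ⟨p, hp, v, hv, hvc, hpv, rfl⟩ := hx
  exact (isExpanded_rep_mk_iff _).mpr (h.isExpanded_mulVec hc hvc (h.words_subset p hp))

/-- Not every line is uniformly expanded: a matrix of large norm contracts some vector. -/
theorem IsAlmostMulMonoid.exists_not_isExpanded (h : IsAlmostMulMonoid Γ κ S) (hS : S.Nonempty)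
    {c : ℝ} (hc : 0 < c) : ∃ x : RP1, ¬ IsExpanded Γ c x.rep := by
  obtain ⟨n, hn⟩ := h.exists_lt_norm (2 / c + 1)
  obtain ⟨p, hp⟩ := words_nonempty (Γ := Γ) hS (n + 1)
  have hpR := hn p hp
  have hpΓ := h.words_subset p hp
  have hdet := h.det_ne_zero hpΓ
  have h1 := norm_le_abs_det_mul hdet
  rw [h.abs_det p hpΓ, one_mul] at h1
  have hp1 := h.one_le_norm hpΓ
  obtain ⟨u, hu, hu'⟩ := exists_lt_nrm_mulVec (g := p⁻¹) (C := ‖p⁻¹‖ / 2) (by positivity)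
    (by linarith)
  have hv : p⁻¹ *ᵥ u ≠ 0 := by
    intro h0
    rw [h0, nrm_zero] at hu'
    have := nrm_nonneg u
    have : 0 ≤ ‖p⁻¹‖ / 2 * nrm u := by positivity
    linarith
  refine ⟨Projectivization.mk ℝ _ hv, fun hexp => ?_⟩
  have h2 := (isExpanded_rep_mk_iff hv).mp hexp p hpΓ
  rw [mulVec_inv_mulVec hdet] at h2
  have h3 := nrm_pos hv
  have h4 := nrm_nonneg u
  set s := nrm (p⁻¹ *ᵥ u)
  have h5 : ‖p‖ / 2 * nrm u < s := lt_of_le_of_lt (by gcongr) hu'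
  have h6 : ‖p‖ / 2 * (c * ‖p‖ * s) ≤ ‖p‖ / 2 * nrm u := by gcongr
  have h7 : 2 < c * ‖p‖ := by
    have : c * (2 / c + 1) < c * ‖p‖ := by gcongr
    have h8 : c * (2 / c + 1) = 2 + c := by field_simp
    linarith
  have h9 : 1 * s < (‖p‖ / 2 * (c * ‖p‖)) * s := by
    refine mul_lt_mul_of_pos_right ?_ h3
    nlinarith
  nlinarith

/-- If the invertible elements of `Γ` are isometries, then there is a multicone that they preserve
and that the elements of `S` map into its interior: the union of small neighbourhoods, of
increasing radii, of the orbit cones of the words of bounded length. -/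
theorem IsAlmostMulMonoid.exists_multicone (h : IsAlmostMulMonoid Γ κ S) (hS : S.Nonempty)
    (horth : ∀ g ∈ Γ, g⁻¹ ∈ Γ → ∀ v, nrm (g *ᵥ v) = nrm v) :
    ∃ C : Set RP1, IsMulticone C ∧
      (∀ H : GL (Fin 2) ℝ, (H : Matrix (Fin 2) (Fin 2) ℝ) ∈ S → imageCone H C ⊆ interior C) ∧
      ∀ E : GL (Fin 2) ℝ, (E : Matrix (Fin 2) (Fin 2) ℝ) ∈ Γ →
        (E : Matrix (Fin 2) (Fin 2) ℝ)⁻¹ ∈ Γ → imageCone E C = C := by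
  have hκ := h.pos
  have hκ1 := h.le_one
  obtain ⟨c, hc⟩ : ∃ c, c = κ / 4 := ⟨_, rfl⟩
  have hc0 : 0 < c := by rw [hc]; positivity
  obtain ⟨N, hN⟩ := h.exists_lt_norm (3 / κ)
  have hlarge : ∀ p ∈ words Γ S (N + 1), 2 ≤ κ * (c * ‖p‖ ^ 2) := by
    intro p hp
    have h1 := (div_lt_iff₀' hκ).mp (hN p hp)
    have h2 : κ * (c * ‖p‖ ^ 2) = (κ * ‖p‖) ^ 2 / 4 := by rw [hc]; ring
    rw [h2]
    nlinarith
  obtain ⟨L, hL1, hL⟩ : ∃ L : ℝ, 1 ≤ L ∧ ∀ H ∈ S, ‖H⁻¹‖ ^ 2 ≤ L := by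
    obtain ⟨B, hB⟩ := (h.finite.image fun H : Matrix (Fin 2) (Fin 2) ℝ => ‖H⁻¹‖ ^ 2).bddAbove
    exact ⟨max 1 B, le_max_left _ _, fun H hH =>
      (hB (mem_image_of_mem _ hH)).trans (le_max_right _ _)⟩
  obtain ⟨η, hη⟩ : ∃ η, η = c * κ / 4 := ⟨_, rfl⟩
  have hη0 : 0 < η := by rw [hη]; positivity
  -- radii that grow by the factor `2 * L` and reach the robustness threshold `η` at `N + 1`
  obtain ⟨ε, hε0, hεs, hεN⟩ : ∃ ε : ℕ → ℝ, (∀ k, 0 < ε k) ∧ (∀ k, ε (k + 1) = 2 * L * ε k) ∧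
      ε (N + 1) = η := by
    refine ⟨fun k => (2 * L) ^ k * (η / (2 * L) ^ (N + 1)), fun k => by positivity,
      fun k => by ring, ?_⟩
    exact mul_div_cancel₀ _ (by positivity)
  have hεmono : Monotone ε := monotone_nat_of_le_succ fun k => by
    rw [hεs]
    nlinarith [hε0 k]
  have hεη : ∀ k ≤ N, 2 * ε k ≤ η := by
    intro k hk
    have h1 := hεmono (show k + 1 ≤ N + 1 by omega)
    rw [hεN, hεs] at h1
    nlinarith [hε0 k]
  set K := orbitCone Γ S c with hK
  set C : Set RP1 := ⋃ k ∈ Iic N, nearCone (K k) (ε k) with hC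
  have hmemC : ∀ {k x}, k ≤ N → x ∈ nearCone (K k) (ε k) → x ∈ C := fun hk hx =>
    mem_biUnion (show _ ∈ Iic N from hk) hx
  -- this keeps `C` away from the lines contracted by some element of `Γ`
  have hC_expanded : ∀ x ∈ C, IsExpanded Γ (c * κ / 2) x.rep := by
    intro x hx
    obtain ⟨k, hk, hx⟩ := mem_iUnion₂.mp hx
    obtain ⟨y, hy, hxy⟩ := exists_lineDist_lt_of_mem_nearCone
      (show ε k < η by linarith [hεη k hk, hε0 k]) hx
    refine isExpanded_rep_of_lineDist_lt ?_ (h.isExpanded_of_mem_orbitCone hc0.le hy) ?_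
    · nlinarith
    · rwa [← hη]
  -- long words bring the lines of `K 0` back, with room to spare: this closes the cycle
  have hlast : ∀ x, ∀ y ∈ K (N + 1), lineDist x y < ε (N + 1) → x ∈ K 0 := by
    rintro x y ⟨p, hp, v, hv, hvc, hpv, rfl⟩ hxy
    have hpΓ := h.words_subset p hp
    have h1 := h.isExpanded_of_large hc0 hpΓ (hlarge p hp) hv (hvc p hpΓ)
    have h2 := isExpanded_rep_of_lineDist_lt (c := κ / 2) (by linarith)
      ((isExpanded_rep_mk_iff hpv).mpr h1) (x := x) ?_
    · refine mem_orbitCone_zero ?_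
      rwa [hc, show κ / 4 = κ / 2 / 2 by ring]
    · rw [hεN, hη] at hxy
      refine lt_of_lt_of_le hxy ?_
      nlinarith
  refine ⟨C, ⟨?_, ?_, ?_⟩, ?_, ?_⟩
  · obtain ⟨p, hp⟩ := words_nonempty (Γ := Γ) hS (N + 1)
    have hpΓ := h.words_subset p hp
    have hp1 := h.one_le_norm hpΓ
    obtain ⟨v, hv, hvp⟩ := exists_lt_nrm_mulVec (g := p) (C := c * ‖p‖) (by positivity)
      (by nlinarith)
    have h1 := h.isExpanded_of_large hc0 hpΓ (hlarge p hp) hv hvp.le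
    have hpv := mulVec_ne_zero (h.det_ne_zero hpΓ) hv
    refine ⟨Projectivization.mk ℝ _ hpv, hmemC (Nat.zero_le N) (subset_nearCone (hε0 0).le
      (mem_orbitCone_zero ((isExpanded_rep_mk_iff hpv).mpr (h1.mono ?_))))⟩
    linarith
  · intro huniv
    obtain ⟨x, hx⟩ := h.exists_not_isExpanded hS (c := c * κ / 2) (by positivity)
    exact hx (hC_expanded x (huniv ▸ mem_univ x))
  · have hF := fun k => exists_finite_intervals_nearCone (K (min k N)) (hε0 (min k N)) (by
      have h1 := hεη (min k N) (min_le_right _ _)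
      nlinarith)
    choose F hFfin hFint hFeq using hF
    refine ⟨⋃ k ∈ Iic N, F k, (finite_Iic N).biUnion fun k _ => hFfin k, ?_, ?_⟩
    · intro I hI
      obtain ⟨k, -, hI⟩ := mem_iUnion₂.mp hI
      exact hFint k I hI
    · rw [sUnion_iUnion]
      refine iUnion_congr fun k => ?_
      rw [sUnion_iUnion]
      refine iUnion_congr fun hk => ?_
      rw [← hFeq, min_eq_left (mem_Iic.mp hk)]
  · rintro H hH _ ⟨x, hx, rfl⟩
    obtain ⟨k, hk, hx⟩ := mem_iUnion₂.mp hx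
    obtain ⟨y, hy, hxy⟩ := exists_lineDist_lt_of_mem_nearCone
      (show ε k < 2 * ε k by linarith [hε0 k]) hx
    have hHy : H • y ∈ K (k + 1) := smul_mem_orbitCone_succ hH hy
    have hd : lineDist (H • x) (H • y) < ε (k + 1) := by
      have h1 := lineDist_smul_le H x y
      rw [h.abs_det _ (h.subset _ hH), one_mul] at h1
      have h2 := hL _ hH
      have h3 := lineDist_nonneg x y
      calc lineDist (H • x) (H • y) ≤ L * lineDist x y := h1.trans (by gcongr)
        _ < L * (2 * ε k) := by gcongr
        _ = ε (k + 1) := by rw [hεs]; ring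
    refine mem_interior_of_lineDist_lt (K := K (k + 1)) (η := ε (k + 1)) ?_ hHy hd
    intro z w hw hzw
    rcases (mem_Iic.mp hk).eq_or_lt with rfl | hlt
    · exact hmemC (Nat.zero_le _) (subset_nearCone (hε0 0).le (hlast z w hw hzw))
    · exact hmemC (show k + 1 ≤ N from hlt) ⟨w, subset_closure hw, hzw.le⟩
  · have hsub : ∀ E : GL (Fin 2) ℝ, (E : Matrix (Fin 2) (Fin 2) ℝ) ∈ Γ →
        (E : Matrix (Fin 2) (Fin 2) ℝ)⁻¹ ∈ Γ → imageCone E C ⊆ C := by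
      rintro E hE hE' _ ⟨x, hx, rfl⟩
      obtain ⟨k, hk, y, hy, hxy⟩ := mem_iUnion₂.mp hx
      refine hmemC (mem_Iic.mp hk) ⟨E • y, ?_, ?_⟩
      · exact map_mem_closure (continuous_smul_RP1 E) hy
          fun z hz => smul_mem_orbitCone horth hc0.le hE hE' hz
      · have h1 := lineDist_smul_le E x y
        rw [h.abs_det _ hE, one_mul] at h1
        have h2 : ‖(E : Matrix (Fin 2) (Fin 2) ℝ)⁻¹‖ ≤ 1 := by
          refine norm_le_of_nrm_mulVec_le zero_le_one fun v => ?_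
          rw [one_mul, horth _ hE' (by
            rw [Matrix.nonsing_inv_nonsing_inv _ (isUnit_iff_ne_zero.mpr (GL_det_ne_zero E))]
            exact hE)]
        have h3 := lineDist_nonneg x y
        have h4 : ‖(E : Matrix (Fin 2) (Fin 2) ℝ)⁻¹‖ ^ 2 ≤ 1 := pow_le_one₀ (norm_nonneg _) h2
        show lineDist (E • x) (E • y) ≤ ε k
        nlinarith
    intro E hE hE'
    refine (hsub E hE hE').antisymm fun x hx => ?_
    refine ⟨E⁻¹ • x, hsub E⁻¹ ?_ ?_ ⟨x, hx, rfl⟩, smul_inv_smul E x⟩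
    · rwa [Matrix.coe_units_inv]
    · rw [Matrix.coe_units_inv, Matrix.nonsing_inv_nonsing_inv _
        (isUnit_iff_ne_zero.mpr (GL_det_ne_zero E))]
      exact hE

/-! ### Invariant Euclidean structures and normalization -/

/-- The binary quadratic form `a x² + 2 b x y + d y²`, encoded by its coefficients `(a, b, d)`. -/
def quadForm (Q : ℝ × ℝ × ℝ) (v : Fin 2 → ℝ) : ℝ :=
  Q.1 * v 0 ^ 2 + 2 * Q.2.1 * (v 0 * v 1) + Q.2.2 * v 1 ^ 2

/-- The discriminant `a d - b²` of a binary quadratic form. -/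
def quadDet (Q : ℝ × ℝ × ℝ) : ℝ := Q.1 * Q.2.2 - Q.2.1 ^ 2

/-- The coefficients of the quadratic form `v ↦ Q (g v)`. -/
def quadComp (Q : ℝ × ℝ × ℝ) (g : Matrix (Fin 2) (Fin 2) ℝ) : ℝ × ℝ × ℝ :=
  (quadForm Q ![g 0 0, g 1 0],
    Q.1 * (g 0 0 * g 0 1) + Q.2.1 * (g 0 0 * g 1 1 + g 1 0 * g 0 1) + Q.2.2 * (g 1 0 * g 1 1),
    quadForm Q ![g 0 1, g 1 1])

theorem quadForm_quadComp (Q : ℝ × ℝ × ℝ) (g : Matrix (Fin 2) (Fin 2) ℝ) (v : Fin 2 → ℝ) :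
    quadForm (quadComp Q g) v = quadForm Q (g *ᵥ v) := by
  simp [quadForm, quadComp, Matrix.mulVec, dotProduct, Fin.sum_univ_two]
  ring

theorem quadDet_quadComp (Q : ℝ × ℝ × ℝ) (g : Matrix (Fin 2) (Fin 2) ℝ) :
    quadDet (quadComp Q g) = g.det ^ 2 * quadDet Q := by
  simp [quadForm, quadComp, quadDet, Matrix.det_fin_two]
  ring

/-- A strict form of the concavity of `quadDet` on nonnegative forms. -/
theorem eq_of_quadDet_add_le {P Q : ℝ × ℝ × ℝ} {D : ℝ} (hD : 0 < D) (hP : quadDet P = D)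
    (hQ : quadDet Q = D) (hP0 : 0 ≤ P.1) (hQ0 : 0 ≤ Q.1)
    (h : quadDet ((P.1 + Q.1) / 2, (P.2.1 + Q.2.1) / 2, (P.2.2 + Q.2.2) / 2) ≤ D) : P = Q := by
  obtain ⟨a, b, d⟩ := P
  obtain ⟨a', b', d'⟩ := Q
  simp only [quadDet] at hP hQ h hP0 hQ0
  have ha : 0 < a := lt_of_le_of_ne hP0 fun h0 => by
    rw [← h0] at hP
    nlinarith [sq_nonneg b]
  have ha' : 0 < a' := lt_of_le_of_ne hQ0 fun h0 => by
    rw [← h0] at hQ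
    nlinarith [sq_nonneg b']
  have h1 : a * d' + a' * d - 2 * (b * b') ≤ 2 * D := by nlinarith
  have h2 : D * (a - a') ^ 2 + (a * b' - a' * b) ^ 2 ≤ 0 := by
    have h3 : a * a' * (a * d' + a' * d - 2 * (b * b')) ≤ a * a' * (2 * D) := by gcongr
    have h4 : a * a' * (a * d' + a' * d - 2 * (b * b')) =
        D * (a ^ 2 + a' ^ 2) + (a * b' - a' * b) ^ 2 := by
      have e1 : a' * d' = D + b' ^ 2 := by linarith
      have e2 : a * d = D + b ^ 2 := by linarith
      linear_combination a ^ 2 * e1 + a' ^ 2 * e2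
    nlinarith
  have h5 : a = a' := by
    have h6 : D * (a - a') ^ 2 = 0 := by
      nlinarith [mul_nonneg hD.le (sq_nonneg (a - a')), sq_nonneg (a * b' - a' * b)]
    rcases mul_eq_zero.mp h6 with h7 | h7
    · exact absurd h7 hD.ne'
    · exact sub_eq_zero.mp (pow_eq_zero_iff two_ne_zero |>.mp h7)
  subst h5
  have h6 : b = b' := by
    have h7 : (a * b' - a * b) ^ 2 = 0 := by
      nlinarith [sq_nonneg (a * b' - a * b)]
    have h8 := pow_eq_zero_iff two_ne_zero |>.mp h7
    have h9 : a * (b' - b) = 0 := by linarith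
    rcases mul_eq_zero.mp h9 with h10 | h10
    · exact absurd h10 ha.ne'
    · linarith
  subst h6
  have h7 : d = d' := mul_left_cancel₀ ha.ne' (by linarith)
  rw [h7]

/-- A bounded monoid of matrices of determinant `±1` preserves a Euclidean structure: the form of
largest discriminant in an invariant compact convex set of nonnegative forms is unique. -/
theorem exists_invariant_norm {G : Submonoid (Matrix (Fin 2) (Fin 2) ℝ)} {B : ℝ}
    (hdet : ∀ g ∈ G, |g.det| = 1) (hB : ∀ g ∈ G, ‖g‖ ≤ B) :
    ∃ M : GL (Fin 2) ℝ, ∀ g ∈ G, ∀ v, nrm ((M : Matrix (Fin 2) (Fin 2) ℝ) *ᵥ (g *ᵥ v)) =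
      nrm ((M : Matrix (Fin 2) (Fin 2) ℝ) *ᵥ v) := by
  set K : Set (ℝ × ℝ × ℝ) := {Q | (∀ v, 0 ≤ quadForm Q v) ∧
    ∀ g ∈ G, quadForm Q (g *ᵥ ![1, 0]) + quadForm Q (g *ᵥ ![0, 1]) ≤ 2 * B ^ 2} with hK
  have hcont : ∀ v, Continuous fun Q => quadForm Q v := fun v => by
    unfold quadForm
    fun_prop
  have hclosed : IsClosed K := by
    have e : K = (⋂ v, {Q | 0 ≤ quadForm Q v}) ∩ ⋂ g ∈ G,
        {Q | quadForm Q (g *ᵥ ![1, 0]) + quadForm Q (g *ᵥ ![0, 1]) ≤ 2 * B ^ 2} := by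
      ext Q
      simp [hK]
    rw [e]
    refine (isClosed_iInter fun v => isClosed_le continuous_const (hcont v)).inter
      (isClosed_biInter fun g _ => isClosed_le ((hcont _).add (hcont _)) continuous_const)
  have hcoef : ∀ Q ∈ K, 0 ≤ Q.1 ∧ 0 ≤ Q.2.2 ∧ Q.1 + Q.2.2 ≤ 2 * B ^ 2 ∧
      0 ≤ Q.1 + 2 * Q.2.1 + Q.2.2 ∧ 0 ≤ Q.1 - 2 * Q.2.1 + Q.2.2 := by
    rintro Q ⟨h1, h2⟩
    have h3 := h2 1 G.one_mem
    have h4 := h1 ![1, 0]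
    have h5 := h1 ![0, 1]
    have h6 := h1 ![1, 1]
    have h7 := h1 ![1, -1]
    simp [quadForm] at h3 h4 h5 h6 h7
    exact ⟨h4, h5, h3, h6, by linarith⟩
  have hcompact : IsCompact K := by
    refine (isCompact_Icc (a := ((0, -(2 * B ^ 2), 0) : ℝ × ℝ × ℝ))
      (b := (2 * B ^ 2, 2 * B ^ 2, 2 * B ^ 2))).of_isClosed_subset hclosed fun Q hQ => ?_
    obtain ⟨h1, h2, h3, h4, h5⟩ := hcoef Q hQ
    refine ⟨⟨h1, ?_, h2⟩, ?_, ?_, ?_⟩ <;> simp only <;> linarith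
  have hone : ((1, 0, 1) : ℝ × ℝ × ℝ) ∈ K := by
    have e : ∀ v, quadForm (1, 0, 1) v = nrm v ^ 2 := fun v => by
      rw [nrm_sq]
      simp [quadForm]
    refine ⟨fun v => by rw [e]; positivity, fun g hg => ?_⟩
    have h1 : ∀ v, nrm v = 1 → quadForm (1, 0, 1) (g *ᵥ v) ≤ B ^ 2 := fun v hv => by
      rw [e]
      have := nrm_mulVec_le g v
      rw [hv, mul_one] at this
      exact pow_le_pow_left₀ (nrm_nonneg _) (this.trans (hB g hg)) 2
    have h2 := h1 ![1, 0] (by simp [nrm])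
    have h3 := h1 ![0, 1] (by simp [nrm])
    linarith
  obtain ⟨Q, hQ, hmax⟩ := hcompact.exists_isMaxOn ⟨_, hone⟩
    (f := quadDet) (by unfold quadDet; fun_prop)
  have hD : 0 < quadDet Q := by
    have h1 : quadDet (1, 0, 1) ≤ quadDet Q := hmax hone
    have h2 : quadDet (1, 0, 1) = 1 := by simp [quadDet]
    linarith
  have hinv : ∀ g ∈ G, quadComp Q g = Q := by
    intro g hg
    have hcomp : quadComp Q g ∈ K := by
      refine ⟨fun v => ?_, fun h hh => ?_⟩
      · rw [quadForm_quadComp]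
        exact hQ.1 _
      · rw [quadForm_quadComp, quadForm_quadComp, Matrix.mulVec_mulVec, Matrix.mulVec_mulVec]
        exact hQ.2 _ (G.mul_mem hg hh)
    have hdet1 : quadDet (quadComp Q g) = quadDet Q := by
      rw [quadDet_quadComp, ← sq_abs, hdet g hg, one_pow, one_mul]
    refine eq_of_quadDet_add_le hD hdet1 rfl (hcoef _ hcomp).1 (hcoef _ hQ).1 (hmax ?_)
    have e : ∀ v, quadForm (((quadComp Q g).1 + Q.1) / 2, ((quadComp Q g).2.1 + Q.2.1) / 2,
        ((quadComp Q g).2.2 + Q.2.2) / 2) v =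
        (quadForm (quadComp Q g) v + quadForm Q v) / 2 := fun v => by
      simp only [quadForm]
      ring
    refine ⟨fun v => ?_, fun h hh => ?_⟩
    · rw [e]
      have := hcomp.1 v
      have := hQ.1 v
      linarith
    · rw [e, e]
      have := hcomp.2 h hh
      have := hQ.2 h hh
      linarith
  have ha : 0 < Q.1 := by
    refine lt_of_le_of_ne (hcoef Q hQ).1 fun h0 => ?_
    have : quadDet Q = Q.1 * Q.2.2 - Q.2.1 ^ 2 := rfl
    rw [← h0] at this
    nlinarith [sq_nonneg Q.2.1]
  -- a square root of the form `Q`, up to the scalar factor `Q.1`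
  have hm : (!![Q.1, Q.2.1; 0, √(quadDet Q)] : Matrix (Fin 2) (Fin 2) ℝ).det ≠ 0 := by
    rw [Matrix.det_fin_two_of]
    have := Real.sqrt_pos.mpr hD
    simp only [mul_zero, sub_zero]
    positivity
  have hM : ∀ v, nrm (!![Q.1, Q.2.1; 0, √(quadDet Q)] *ᵥ v) ^ 2 = Q.1 * quadForm Q v := by
    intro v
    rw [nrm_sq]
    simp [Matrix.mulVec, dotProduct, Fin.sum_univ_two, quadForm]
    rw [mul_pow, Real.sq_sqrt hD.le, quadDet]
    ring
  refine ⟨Matrix.GeneralLinearGroup.mkOfDetNeZero _ hm, fun g hg v => ?_⟩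
  refine (sq_eq_sq₀ (nrm_nonneg _) (nrm_nonneg _)).mp ?_
  change nrm (!![Q.1, Q.2.1; 0, √(quadDet Q)] *ᵥ (g *ᵥ v)) ^ 2 =
    nrm (!![Q.1, Q.2.1; 0, √(quadDet Q)] *ᵥ v) ^ 2
  rw [hM, hM, ← quadForm_quadComp, hinv g hg]

/-- Conjugation by an invertible matrix. -/
def conjHom (M : GL (Fin 2) ℝ) : Matrix (Fin 2) (Fin 2) ℝ →* Matrix (Fin 2) (Fin 2) ℝ where
  toFun m := (M⁻¹ : GL (Fin 2) ℝ) * m * (M : Matrix (Fin 2) (Fin 2) ℝ)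
  map_one' := by simp
  map_mul' m n := by
    have : (M : Matrix (Fin 2) (Fin 2) ℝ) * (M⁻¹ : GL (Fin 2) ℝ) = 1 := M.mul_inv
    rw [show ∀ x y : Matrix (Fin 2) (Fin 2) ℝ, x * m * M * (y * n * M) =
      x * m * (M * y) * n * M by intros; simp only [mul_assoc], this]
    simp only [mul_assoc, one_mul]

theorem conjHom_apply (M : GL (Fin 2) ℝ) (m : Matrix (Fin 2) (Fin 2) ℝ) :
    conjHom M m = (M⁻¹ : GL (Fin 2) ℝ) * m * (M : Matrix (Fin 2) (Fin 2) ℝ) := rfl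

theorem eq_mul_conjHom_mul (M : GL (Fin 2) ℝ) (m : Matrix (Fin 2) (Fin 2) ℝ) :
    m = (M : Matrix (Fin 2) (Fin 2) ℝ) * conjHom M m * (M⁻¹ : GL (Fin 2) ℝ) := by
  rw [conjHom_apply, mul_assoc, mul_assoc, mul_assoc, M.mul_inv, mul_one, M.mul_inv_cancel_left]

theorem conjHom_inv (M : GL (Fin 2) ℝ) (m : Matrix (Fin 2) (Fin 2) ℝ) :
    conjHom M m⁻¹ = (conjHom M m)⁻¹ := by
  rw [conjHom_apply, conjHom_apply, Matrix.mul_inv_rev, Matrix.mul_inv_rev,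
    ← Matrix.coe_units_inv, ← Matrix.coe_units_inv, inv_inv, mul_assoc]

theorem det_conjHom (M : GL (Fin 2) ℝ) (m : Matrix (Fin 2) (Fin 2) ℝ) :
    (conjHom M m).det = m.det := by
  rw [conjHom_apply, Matrix.det_units_conj']

theorem IsAlmostMulMonoid.conj {Γ : Submonoid (Matrix (Fin 2) (Fin 2) ℝ)} {κ : ℝ}
    {S : Set (Matrix (Fin 2) (Fin 2) ℝ)} (h : IsAlmostMulMonoid Γ κ S) (M : GL (Fin 2) ℝ) :
    ∃ κ', IsAlmostMulMonoid (Γ.comap (conjHom M)) κ' (conjHom M ⁻¹' S) := by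
  set t := ‖(M : Matrix (Fin 2) (Fin 2) ℝ)‖ * ‖((M⁻¹ : GL (Fin 2) ℝ) : Matrix (Fin 2) (Fin 2) ℝ)‖
    with ht
  have ht1 : 1 ≤ t := by
    have := norm_mul_le (M : Matrix (Fin 2) (Fin 2) ℝ) (M⁻¹ : GL (Fin 2) ℝ)
    rwa [M.mul_inv, norm_one_mat] at this
  have hκ := h.pos
  have hup : ∀ m, ‖conjHom M m‖ ≤ t * ‖m‖ := fun m => by
    rw [conjHom_apply]
    refine (norm_mul_le _ _).trans ?_
    calc _ ≤ (‖((M⁻¹ : GL (Fin 2) ℝ) : Matrix (Fin 2) (Fin 2) ℝ)‖ * ‖m‖) *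
          ‖(M : Matrix (Fin 2) (Fin 2) ℝ)‖ :=
          mul_le_mul_of_nonneg_right (norm_mul_le _ _) (norm_nonneg _)
      _ = t * ‖m‖ := by rw [ht]; ring
  have hdown : ∀ m, ‖m‖ ≤ t * ‖conjHom M m‖ := fun m => by
    conv_lhs => rw [eq_mul_conjHom_mul M m]
    refine (norm_mul_le _ _).trans ?_
    calc _ ≤ (‖(M : Matrix (Fin 2) (Fin 2) ℝ)‖ * ‖conjHom M m‖) *
          ‖((M⁻¹ : GL (Fin 2) ℝ) : Matrix (Fin 2) (Fin 2) ℝ)‖ :=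
          mul_le_mul_of_nonneg_right (norm_mul_le _ _) (norm_nonneg _)
      _ = t * ‖conjHom M m‖ := by rw [ht]; ring
  refine ⟨κ / t ^ 3, ?_, fun g hg => ?_, by positivity, ?_, fun g hg k hk => ?_, ?_,
    fun H hH => h.subset _ hH, fun H hH hH' => h.inv_notMem _ hH ?_⟩
  · refine h.isClosed.preimage ?_
    change Continuous fun m => (((M⁻¹ : GL (Fin 2) ℝ) : Matrix (Fin 2) (Fin 2) ℝ) * m *
      (M : Matrix (Fin 2) (Fin 2) ℝ))
    fun_prop
  · rw [← det_conjHom M]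
    exact h.abs_det _ hg
  · exact div_le_one_of_le₀ (h.le_one.trans (one_le_pow₀ ht1)) (by positivity)
  · have h1 := h.mul_le _ hg _ hk
    rw [← map_mul] at h1
    have h2 := mul_le_mul (hdown g) (hdown k) (norm_nonneg _)
      (mul_nonneg (zero_le_one.trans ht1) (norm_nonneg _))
    have h3 : κ * ‖g‖ * ‖k‖ ≤ t ^ 3 * ‖g * k‖ := by
      calc κ * ‖g‖ * ‖k‖ = κ * (‖g‖ * ‖k‖) := mul_assoc _ _ _
        _ ≤ κ * (t * ‖conjHom M g‖ * (t * ‖conjHom M k‖)) := mul_le_mul_of_nonneg_left h2 hκ.le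
        _ = t ^ 2 * (κ * ‖conjHom M g‖ * ‖conjHom M k‖) := by ring
        _ ≤ t ^ 2 * (t * ‖g * k‖) := mul_le_mul_of_nonneg_left (h1.trans (hup _)) (sq_nonneg t)
        _ = _ := by ring
    rw [div_mul_eq_mul_div, div_mul_eq_mul_div]
    exact div_le_of_le_mul₀ (by positivity) (norm_nonneg _) (by linarith)
  · refine h.finite.preimage (Function.Injective.injOn fun m n hmn => ?_)
    rw [eq_mul_conjHom_mul M m, hmn, ← eq_mul_conjHom_mul]
  · rw [← conjHom_inv]
    exact hH'

theorem mem_orthogonalGroup_of_nrm {U : Matrix (Fin 2) (Fin 2) ℝ}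
    (hU : ∀ v, nrm (U *ᵥ v) = nrm v) : U ∈ Matrix.orthogonalGroup (Fin 2) ℝ := by
  rw [Matrix.mem_orthogonalGroup_iff']
  have e : ∀ v, nrm (U *ᵥ v) ^ 2 = nrm v ^ 2 := fun v => by rw [hU]
  have h1 := e ![1, 0]
  have h2 := e ![0, 1]
  have h3 := e ![1, 1]
  simp [nrm_sq] at h1 h2 h3
  ext i j
  fin_cases i <;> fin_cases j <;>
    simp [Matrix.mul_apply, Fin.sum_univ_two] <;> nlinarith

/-- The normalization of an invertible matrix to determinant `±1`. -/
noncomputable def normalize (g : GL (Fin 2) ℝ) : Matrix (Fin 2) (Fin 2) ℝ :=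
  |(g : Matrix (Fin 2) (Fin 2) ℝ).det| ^ (-(1 / 2) : ℝ) • (g : Matrix (Fin 2) (Fin 2) ℝ)

theorem normalize_factor_pos (g : GL (Fin 2) ℝ) :
    0 < |(g : Matrix (Fin 2) (Fin 2) ℝ).det| ^ (-(1 / 2) : ℝ) :=
  Real.rpow_pos_of_pos (abs_pos.mpr (GL_det_ne_zero g)) _

theorem abs_det_normalize (g : GL (Fin 2) ℝ) : |(normalize g).det| = 1 := by
  have h0 := abs_pos.mpr (GL_det_ne_zero g)
  rw [normalize, Matrix.det_smul, abs_mul, Fintype.card_fin,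
    abs_of_pos (pow_pos (normalize_factor_pos g) 2), ← Real.rpow_mul_natCast h0.le]
  norm_num
  rw [Real.rpow_neg_one, inv_mul_cancel₀ h0.ne']

/-- Proportional matrices act in the same way on the projective line. -/
theorem imageCone_eq_of_smul {g g' : GL (Fin 2) ℝ} {r : ℝ}
    (h : (g' : Matrix (Fin 2) (Fin 2) ℝ) = r • (g : Matrix (Fin 2) (Fin 2) ℝ)) (C : Set RP1) :
    imageCone g' C = imageCone g C := by
  unfold imageCone
  congr 1
  ext x
  induction x using Projectivization.ind with
  | h v hv =>
    rw [smul_mk_eq, smul_mk_eq, mk_eq_mk_iff']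
    exact ⟨r, by rw [h, Matrix.smul_mulVec]⟩

theorem exists_isAlmostMulMonoid {A : Set (GL (Fin 2) ℝ)} (hA : A.Finite)
    (h : AlmostMultiplicative (Subsemigroup.closure A)) :
    ∃ (Γ : Submonoid (Matrix (Fin 2) (Fin 2) ℝ)) (κ : ℝ), (∀ g ∈ A, normalize g ∈ Γ) ∧
      IsAlmostMulMonoid Γ κ (normalize '' {g ∈ A | (normalize g)⁻¹ ∉ Γ}) := by
  obtain ⟨κ, hκ, hmul⟩ := h
  set Γ₀ := Submonoid.closure (normalize '' A) with hΓ₀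
  have hrep : ∀ m ∈ Γ₀, m = 1 ∨ ∃ g ∈ Subsemigroup.closure A, ∃ r : ℝ, 0 < r ∧
      m = r • (g : Matrix (Fin 2) (Fin 2) ℝ) := by
    intro m hm
    induction hm using Submonoid.closure_induction with
    | mem x hx =>
      obtain ⟨g, hg, rfl⟩ := hx
      exact Or.inr ⟨g, Subsemigroup.subset_closure hg, _, normalize_factor_pos g, rfl⟩
    | one => exact Or.inl rfl
    | mul x y _ _ hx hy =>
      rcases hx with rfl | ⟨g, hg, r, hr, rfl⟩
      · rwa [one_mul]
      · rcases hy with rfl | ⟨g', hg', r', hr', rfl⟩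
        · rw [mul_one]
          exact Or.inr ⟨g, hg, r, hr, rfl⟩
        · refine Or.inr ⟨g * g', mul_mem hg hg', r * r', mul_pos hr hr', ?_⟩
          rw [smul_mul_smul_comm, Units.val_mul]
  have hmul₀ : ∀ m ∈ Γ₀, ∀ n ∈ Γ₀, min κ 1 * ‖m‖ * ‖n‖ ≤ ‖m * n‖ := by
    intro m hm n hn
    rcases hrep m hm with rfl | ⟨g, hg, r, hr, rfl⟩
    · rw [norm_one_mat, mul_one, one_mul]
      exact mul_le_of_le_one_left (norm_nonneg _) (min_le_right _ _)
    · rcases hrep n hn with rfl | ⟨g', hg', r', hr', rfl⟩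
      · rw [norm_one_mat, mul_one, mul_one]
        exact mul_le_of_le_one_left (norm_nonneg _) (min_le_right _ _)
      · have h1 : κ * ‖(g : Matrix (Fin 2) (Fin 2) ℝ)‖ * ‖(g' : Matrix (Fin 2) (Fin 2) ℝ)‖ ≤
            ‖(g : Matrix (Fin 2) (Fin 2) ℝ) * (g' : Matrix (Fin 2) (Fin 2) ℝ)‖ := hmul g hg g' hg'
        rw [smul_mul_smul_comm, norm_smul, norm_smul, norm_smul, Real.norm_of_nonneg hr.le,
          Real.norm_of_nonneg hr'.le, Real.norm_of_nonneg (mul_pos hr hr').le]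
        calc min κ 1 * (r * ‖(g : Matrix (Fin 2) (Fin 2) ℝ)‖) *
              (r' * ‖(g' : Matrix (Fin 2) (Fin 2) ℝ)‖)
            = r * r' * (min κ 1 * ‖(g : Matrix (Fin 2) (Fin 2) ℝ)‖ *
              ‖(g' : Matrix (Fin 2) (Fin 2) ℝ)‖) := by ring
          _ ≤ r * r' * (κ * ‖(g : Matrix (Fin 2) (Fin 2) ℝ)‖ *
              ‖(g' : Matrix (Fin 2) (Fin 2) ℝ)‖) := by
              have := min_le_left κ 1
              gcongr
          _ ≤ _ := by gcongr
  have hdet₀ : ∀ m ∈ Γ₀, |m.det| = 1 := by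
    intro m hm
    induction hm using Submonoid.closure_induction with
    | mem x hx =>
      obtain ⟨g, -, rfl⟩ := hx
      exact abs_det_normalize g
    | one => simp
    | mul x y _ _ hx hy => rw [Matrix.det_mul, abs_mul, hx, hy, one_mul]
  have hsub : ∀ g ∈ A, normalize g ∈ Γ₀.topologicalClosure := fun g hg =>
    Γ₀.le_topologicalClosure (Submonoid.subset_closure ⟨g, hg, rfl⟩)
  refine ⟨Γ₀.topologicalClosure, min κ 1, hsub, Γ₀.isClosed_topologicalClosure, ?_,
    lt_min hκ one_pos, min_le_right _ _, ?_, (hA.subset (sep_subset _ _)).image _, ?_, ?_⟩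
  · intro g hg
    have hc : IsClosed {m : Matrix (Fin 2) (Fin 2) ℝ | |m.det| = 1} :=
      isClosed_eq (by fun_prop) continuous_const
    have hsub' : (Γ₀ : Set (Matrix (Fin 2) (Fin 2) ℝ)) ⊆ {m | |m.det| = 1} :=
      fun m hm => hdet₀ m hm
    exact closure_minimal hsub' hc hg
  · intro g hg k hk
    have hc : Continuous (Function.uncurry fun m n : Matrix (Fin 2) (Fin 2) ℝ =>
        ‖m * n‖ - min κ 1 * ‖m‖ * ‖n‖) := by
      unfold Function.uncurry
      fun_prop
    have := map_mem_closure₂ (u := Ici (0 : ℝ)) hc hg hk fun m hm n hn =>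
      sub_nonneg.mpr (hmul₀ m hm n hn)
    rw [closure_Ici] at this
    exact sub_nonneg.mp this
  · rintro _ ⟨g, ⟨hg, -⟩, rfl⟩
    exact hsub g hg
  · rintro _ ⟨g, ⟨-, hg⟩, rfl⟩
    exact hg

/-- The members of a monoid of matrices whose inverses are members as well. -/
def invertibleMembers (Γ : Submonoid (Matrix (Fin 2) (Fin 2) ℝ)) :
    Submonoid (Matrix (Fin 2) (Fin 2) ℝ) where
  carrier := {g | g ∈ Γ ∧ g⁻¹ ∈ Γ}
  one_mem' := ⟨Γ.one_mem, by rw [inv_one]; exact Γ.one_mem⟩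
  mul_mem' ha hb := ⟨Γ.mul_mem ha.1 hb.1, by
    rw [Matrix.mul_inv_rev]
    exact Γ.mul_mem hb.2 ha.2⟩

/-- The invertible members of an almost multiplicative monoid form a bounded group, since
`1 = ‖g g⁻¹‖ ≥ κ ‖g‖ ‖g⁻¹‖`; so they preserve a Euclidean structure. -/
theorem IsAlmostMulMonoid.exists_invariant_norm {Γ : Submonoid (Matrix (Fin 2) (Fin 2) ℝ)} {κ : ℝ}
    {S : Set (Matrix (Fin 2) (Fin 2) ℝ)} (h : IsAlmostMulMonoid Γ κ S) :
    ∃ M : GL (Fin 2) ℝ, ∀ g ∈ Γ, g⁻¹ ∈ Γ → ∀ v,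
      nrm ((M : Matrix (Fin 2) (Fin 2) ℝ) *ᵥ (g *ᵥ v)) =
      nrm ((M : Matrix (Fin 2) (Fin 2) ℝ) *ᵥ v) := by
  obtain ⟨M, hM⟩ := PlanarCocycle.exists_invariant_norm (G := invertibleMembers Γ) (B := κ⁻¹)
    (fun g hg => h.abs_det g hg.1) fun g hg => by
      have h1 := h.mul_le g hg.1 g⁻¹ hg.2
      have h2 := h.one_le_norm hg.2
      have hκ := h.pos
      rw [Matrix.mul_nonsing_inv _ (isUnit_iff_ne_zero.mpr (h.det_ne_zero hg.1)), norm_one_mat]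
        at h1
      rw [← one_div, le_div_iff₀' hκ]
      exact (le_mul_of_one_le_right (by positivity) h2).trans h1
  exact ⟨M, fun g hg hg' => hM g ⟨hg, hg'⟩⟩

theorem exists_multicone_of_almostMultiplicative {A : Set (GL (Fin 2) ℝ)} (hA : A.Finite)
    (h : AlmostMultiplicative (Subsemigroup.closure A)) :
    ∃ Ae Ah : Set (GL (Fin 2) ℝ), A = Ae ∪ Ah ∧ StronglyConformal Ae ∧
      (Ah.Nonempty → ∃ C : Set RP1, IsStronglyInvariantMulticone C Ah ∧
        ∀ g ∈ Ae, imageCone g C = C) := by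
  obtain ⟨Γ, κ, hAΓ, hΓ⟩ := exists_isAlmostMulMonoid hA h
  obtain ⟨M, hM⟩ := hΓ.exists_invariant_norm
  -- the normalized conjugate of `g`, as an element of the general linear group
  have hnorm : ∀ g : GL (Fin 2) ℝ, ∃ g' : GL (Fin 2) ℝ,
      (g' : Matrix (Fin 2) (Fin 2) ℝ) = |(g : Matrix (Fin 2) (Fin 2) ℝ).det| ^ (-(1 / 2) : ℝ) •
        ((M * g * M⁻¹ : GL (Fin 2) ℝ) : Matrix (Fin 2) (Fin 2) ℝ) ∧
      conjHom M (g' : Matrix (Fin 2) (Fin 2) ℝ) = normalize g := by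
    intro g
    refine ⟨Matrix.GeneralLinearGroup.mkOfDetNeZero
      (|(g : Matrix (Fin 2) (Fin 2) ℝ).det| ^ (-(1 / 2) : ℝ) •
        ((M * g * M⁻¹ : GL (Fin 2) ℝ) : Matrix (Fin 2) (Fin 2) ℝ)) ?_, rfl, ?_⟩
    · rw [Matrix.det_smul]
      exact mul_ne_zero (pow_ne_zero _ (normalize_factor_pos g).ne') (GL_det_ne_zero _)
    · change conjHom M (_ • _) = _
      rw [conjHom_apply, mul_smul_comm, smul_mul_assoc, normalize, ← Units.val_mul,
        ← Units.val_mul]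
      congr 2
      group
  have horth : ∀ g ∈ Γ.comap (conjHom M), g⁻¹ ∈ Γ.comap (conjHom M) →
      ∀ v, nrm (g *ᵥ v) = nrm v := by
    intro g hg hg' v
    have h1 : (conjHom M g)⁻¹ ∈ Γ := by
      rw [← conjHom_inv]
      exact hg'
    have h2 := hM _ hg h1 (((M⁻¹ : GL (Fin 2) ℝ) : Matrix (Fin 2) (Fin 2) ℝ) *ᵥ v)
    rw [Matrix.mulVec_mulVec, Matrix.mulVec_mulVec, ← eq_mul_conjHom_mul,
      Matrix.mulVec_mulVec, M.mul_inv, Matrix.one_mulVec] at h2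
    exact h2
  refine ⟨{g ∈ A | (normalize g)⁻¹ ∈ Γ}, {g ∈ A | (normalize g)⁻¹ ∉ Γ}, ?_, ⟨M, ?_⟩, ?_⟩
  · ext g
    simp only [mem_union, mem_ofPred_eq]
    tauto
  · rintro g ⟨hgA, hg⟩
    obtain ⟨g', hg', hconj⟩ := hnorm g
    rw [← hg']
    refine mem_orthogonalGroup_of_nrm (horth _ ?_ ?_)
    · change conjHom M _ ∈ Γ
      rw [hconj]
      exact hAΓ g hgA
    · change conjHom M _ ∈ Γ
      rw [conjHom_inv, hconj]
      exact hg
  · rintro ⟨g₀, hg₀⟩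
    obtain ⟨κ', hΓ'⟩ := hΓ.conj M
    obtain ⟨C, hC, hCh, hCe⟩ := hΓ'.exists_multicone (by
      obtain ⟨g', -, hconj⟩ := hnorm g₀
      exact ⟨g', g₀, hg₀, hconj.symm⟩) horth
    have hcomm : ∀ g : GL (Fin 2) ℝ, imageCone g (imageCone M⁻¹ C) =
        imageCone M⁻¹ (imageCone (M * g * M⁻¹) C) := by
      intro g
      rw [← imageCone_mul, ← imageCone_mul]
      congr 1
      group
    refine ⟨imageCone M⁻¹ C, ⟨hC.imageCone _, fun g hg => ?_⟩, fun g hg => ?_⟩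
    · obtain ⟨g', hg', hconj⟩ := hnorm g
      rw [hcomm, ← imageCone_eq_of_smul hg']
      refine (image_mono (hCh g' ?_)).trans (imageCone_interior_subset _ _)
      exact ⟨g, hg, hconj.symm⟩
    · obtain ⟨g', hg', hconj⟩ := hnorm g
      rw [hcomm, ← imageCone_eq_of_smul hg', hCe g' ?_ ?_]
      · change conjHom M _ ∈ Γ
        rw [hconj]
        exact hAΓ g hg.1
      · change conjHom M _ ∈ Γ
        rw [conjHom_inv, hconj]
        exact hg.2

end PlanarCocycle

theorem corollary2p5 (A : Set (GL (Fin 2) ℝ)) (hA : A.Finite) :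
    PlanarCocycle.AlmostMultiplicative (Subsemigroup.closure A) ↔
      ∃ Ae Ah : Set (GL (Fin 2) ℝ), A = Ae ∪ Ah ∧
        PlanarCocycle.StronglyConformal Ae ∧
        (Ah.Nonempty → ∃ C : Set PlanarCocycle.RP1,
          PlanarCocycle.IsStronglyInvariantMulticone C Ah ∧
          ∀ g ∈ Ae, PlanarCocycle.imageCone g C = C) := by
  refine ⟨PlanarCocycle.exists_multicone_of_almostMultiplicative hA, ?_⟩
  rintro ⟨Ae, Ah, rfl, he, hh⟩
  exact PlanarCocycle.almostMultiplicative_of_multicone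
    (hA.subset Set.subset_union_right) he hh
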